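/- A \emph{quandle} is a set $Q$ with operations $*,\backslash$ such that $a*(a\backslash b)=a\backslash(a*b)=b$, $a*(b*c)=(a*b)*(a*c)$ and $a*a=a$; write $L_a(b)=a*b$. Subquandles and congruences are taken with respect to both operations; a subquandle is \emph{proper} if it is different from the whole quandle and has more than one element. A quandle is \emph{strictly simple} if it has no proper subquandles, and \emph{locally strictly simple} if all its proper subquandles are strictly simple. The displacement group $\mathrm{Dis}(Q)$ is the group of permutations of $Q$ generated by all $L_aL_b^{-1}$ ($a,b\in Q$), and $Q$ is \emph{connected} if the group generated by all $L_a$ acts transitively on $Q$. Let $\sigma_Q$ be the equivalence relation on $Q$ defined by $a\,\sigma_Q\,b$ if and only if $\mathrm{Dis}(Q)_a=\mathrm{Dis}(Q)_b$ (point stabilizers). \emph{Abelian} is meant in the sense of commutator theory: for every term $t$ and all tuples $a,b,u,v$ of elements, $t(a,u)=t(a,v)$ implies $t(b,u)=t(b,v)$. Let $\gamma_Q$ be the smallest congruence of $Q$ with abelian factor, and let $0_Q$ be the identity relation. For primes $p,q$ and natural numbers $m,n$, $\mathcal{LSS}(p^m,q^n,\sigma_Q)$ denotes the class of finite, non-abelian,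 subdirectly irreducible, connected, locally strictly simple quandles $Q$ (with the given $\sigma_Q$) that have exactly one congruence different from $0_Q$ and $Q\times Q$, where the factor by this congruence has $q^n$ elements and each of its blocks has $p^m$ elements. \textbf{Theorem.} Let $p,q$ be primes, let $Q\in\mathcal{LSS}(p^m,q^n,\sigma_Q)$ and suppose that $\sigma_Q\wedge\gamma_Q=0_Q$. Then there are an integer $0\le k\le m$, an extraspecial $q$-group $K$ (that is, a finite $q$-group with $Z(K)=[K,K]=\Phi(K)$ of order $q$) and a homomorphism $\rho:K\to\mathrm{Aut}(\mathbb{Z}_p^{m+k})$ such that $$\mathrm{Dis}(Q)\cong \mathbb{Z}_p^{m+k}\rtimes_\rho K,$$ and $K$ has exponent $q$ if $q$ is odd. Moreover $q$ divides $p^m-1$ and $n$ is even. -/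

import Mathlib

open scoped Quandles

namespace LSSQuandle

universe u

/-! ### Congruences and subquandles -/

/-- A congruence of a quandle, as an algebra with the two operations `◃` and `◃⁻¹`. -/
structure QCon (Q : Type u) [Quandle Q] extends Setoid Q where
  act_congr : ∀ {a b c d : Q}, toSetoid a b → toSetoid c d → toSetoid (a ◃ c) (b ◃ d)
  invAct_congr : ∀ {a b c d : Q}, toSetoid a b → toSetoid c d → toSetoid (a ◃⁻¹ c) (b ◃⁻¹ d)

/-- The factor algebra of a quandle modulo a congruence. -/
def QCon.Factor {Q : Type u} [Quandle Q] (α : QCon Q) : Type u := Quotient α.toSetoid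

instance {Q : Type u} [Quandle Q] (α : QCon Q) : Quandle α.Factor where
  act := Quotient.map₂ Shelf.act fun _ _ h _ _ h' => α.act_congr h h'
  invAct := Quotient.map₂ Rack.invAct fun _ _ h _ _ h' => α.invAct_congr h h'
  self_distrib := by
    rintro ⟨x⟩ ⟨y⟩ ⟨z⟩
    exact congrArg (Quotient.mk α.toSetoid) Shelf.self_distrib
  left_inv := by
    rintro ⟨x⟩ ⟨y⟩
    exact congrArg (Quotient.mk α.toSetoid) (Rack.left_inv x y)
  right_inv := by
    rintro ⟨x⟩ ⟨y⟩
    exact congrArg (Quotient.mk α.toSetoid) (Rack.right_inv x y)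
  fix := by
    rintro ⟨x⟩
    exact congrArg (Quotient.mk α.toSetoid) Quandle.fix

/-- A subquandle: a subset closed under both operations. -/
structure Subquandle (Q : Type u) [Quandle Q] where
  carrier : Set Q
  act_mem : ∀ {a b : Q}, a ∈ carrier → b ∈ carrier → a ◃ b ∈ carrier
  invAct_mem : ∀ {a b : Q}, a ∈ carrier → b ∈ carrier → a ◃⁻¹ b ∈ carrier

instance {Q : Type u} [Quandle Q] (S : Subquandle Q) : Quandle S.carrier where
  act a b := ⟨a.1 ◃ b.1, S.act_mem a.2 b.2⟩
  invAct a b := ⟨a.1 ◃⁻¹ b.1, S.invAct_mem a.2 b.2⟩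
  self_distrib := Subtype.ext Shelf.self_distrib
  left_inv a b := Subtype.ext (Rack.left_inv a.1 b.1)
  right_inv a b := Subtype.ext (Rack.right_inv a.1 b.1)
  fix := Subtype.ext Quandle.fix

/-- Proper subquandles are different from the whole quandle and have more than one element. -/
def Subquandle.IsProper {Q : Type u} [Quandle Q] (S : Subquandle Q) : Prop :=
  S.carrier ≠ Set.univ ∧ S.carrier.Nontrivial

/-- Strictly simple: there is no proper subquandle. -/
def IsStrictlySimple (Q : Type u) [Quandle Q] : Prop :=
  ∀ S : Subquandle Q, ¬ S.IsProper

/-- Locally strictly simple: all proper subquandles are strictly simple. -/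
def IsLocallyStrictlySimple (Q : Type u) [Quandle Q] : Prop :=
  ∀ S : Subquandle Q, S.IsProper → IsStrictlySimple S.carrier

/-! ### Multiplication groups -/

/-- The left multiplication group, generated by the left multiplications `L_a : b ↦ a ◃ b`. -/
def LMlt (Q : Type u) [Quandle Q] : Subgroup (Equiv.Perm Q) :=
  Subgroup.closure {g | ∃ a : Q, g = Rack.act' a}

/-- The displacement group, generated by the `L_a L_b⁻¹`. -/
def Dis (Q : Type u) [Quandle Q] : Subgroup (Equiv.Perm Q) :=
  Subgroup.closure {g | ∃ a b : Q, g = Rack.act' a * (Rack.act' b)⁻¹}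

/-- Connected: the left multiplication group acts transitively. -/
def IsConnectedQuandle (Q : Type u) [Quandle Q] : Prop :=
  MulAction.IsPretransitive (LMlt Q) Q

/-- The relation `σ_Q`: two elements have the same stabilizer in the displacement group. -/
def sigma (Q : Type u) [Quandle Q] : Setoid Q :=
  Setoid.ker fun a : Q => MulAction.stabilizer (Dis Q) a

/-! ### Abelian quandles in the sense of commutator theory -/

/-- Terms in the language of quandles over a set of variables. -/
inductive QTerm (X : Type) : Type
  | var : X → QTerm X
  | act : QTerm X → QTerm X → QTerm X
  | invAct : QTerm X → QTerm X → QTerm X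

/-- The value of a term under an assignment of the variables. -/
def QTerm.eval {X : Type} {Q : Type u} [Quandle Q] (v : X → Q) : QTerm X → Q
  | .var x => v x
  | .act s t => s.eval v ◃ t.eval v
  | .invAct s t => s.eval v ◃⁻¹ t.eval v

/-- An abelian algebra in the sense of commutator theory (`[1_Q, 1_Q] = 0_Q`): the term condition
`t(a, u) = t(a, v) → t(b, u) = t(b, v)` holds for all terms `t` and all tuples `a, b, u, v`. -/
def IsAbelianQuandle (Q : Type u) [Quandle Q] : Prop :=
  ∀ (k l : ℕ) (t : QTerm (Fin k ⊕ Fin l)) (a b : Fin k → Q) (u v : Fin l → Q),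
    t.eval (Sum.elim a u) = t.eval (Sum.elim a v) →
      t.eval (Sum.elim b u) = t.eval (Sum.elim b v)

/-- The smallest congruence `γ_Q` with abelian factor: the intersection of all of them
(its factor is again abelian, as the term condition passes to subdirect products). -/
def gamma (Q : Type u) [Quandle Q] : QCon Q where
  toSetoid := sInf {s | ∃ α : QCon Q, IsAbelianQuandle α.Factor ∧ s = α.toSetoid}
  act_congr := by
    rintro a b c d h h' _ ⟨α, hα, rfl⟩
    exact α.act_congr (h _ ⟨α, hα, rfl⟩) (h' _ ⟨α, hα, rfl⟩)
  invAct_congr := by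
    rintro a b c d h h' _ ⟨α, hα, rfl⟩
    exact α.invAct_congr (h _ ⟨α, hα, rfl⟩) (h' _ ⟨α, hα, rfl⟩)

/-! ### The classes `LSS(p^m, q^n, σ_Q)` -/

/-- Subdirectly irreducible: the intersection of all non-trivial congruences is non-trivial. -/
def IsSubdirectlyIrreducible (Q : Type u) [Quandle Q] : Prop :=
  sInf {s | ∃ α : QCon Q, α.toSetoid ≠ ⊥ ∧ s = α.toSetoid} ≠ ⊥

/-- The class `LSS(B, F, σ)` of finite, non-abelian, subdirectly irreducible, connected, locally
strictly simple quandles `Q` with `σ_Q = σ`, having exactly one congruence different from `0_Q`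
and `1_Q`, the factor of which has `F` elements and the blocks of which have `B` elements. -/
structure InLSS (B F : ℕ) (Q : Type u) [Quandle Q] (σ : Setoid Q) : Prop where
  finite : Finite Q
  connected : IsConnectedQuandle Q
  locallyStrictlySimple : IsLocallyStrictlySimple Q
  not_abelian : ¬ IsAbelianQuandle Q
  subdirectlyIrreducible : IsSubdirectlyIrreducible Q
  exists_unique_congruence : ∃ α : QCon Q,
    (∀ β : QCon Q, (β.toSetoid ≠ ⊥ ∧ β.toSetoid ≠ ⊤) ↔ β = α) ∧
      Nat.card α.Factor = F ∧ ∀ a : Q, {b : Q | α.toSetoid a b}.ncard = B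
  sigma_eq : sigma Q = σ

/-- An extraspecial `q`-group: a finite `q`-group whose centre has order `q` and coincides with
the derived subgroup and with the Frattini subgroup. -/
structure IsExtraspecial (q : ℕ) (K : Type u) [Group K] : Prop where
  finite : Finite K
  isPGroup : IsPGroup q K
  card_center : Nat.card (Subgroup.center K) = q
  commutator_eq : commutator K = Subgroup.center K
  frattini_eq : frattini K = Subgroup.center K

end LSSQuandle

namespace LSSQuandle

open scoped commutatorElement

/-! ### Alternating forms and extraspecial groups -/

/-! Let `α` be the unique nontrivial congruence, and let `D` be the subgroup of `Dis Q` fixing every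
block of `α`. Local strict simplicity makes both the factor and the blocks strictly simple. An
automorphism of a strictly simple quandle with two fixed points is the identity, so a transitive
automorphism group of such a quandle, of prime power degree and normalised by some `L_a`, is either
regular or Frobenius. Its kernel is regular and elementary abelian, and `L_a` acts irreducibly on it
(`IsStrictlySimple.exists_regular`). Hence `Dis Q / D` is elementary abelian of order `q ^ n`, and
the elements of `D` acting semiregularly on all blocks form an elementary abelian normal
`p`-subgroup `C.kernel`.

Every `L_a` centralises `D` modulo `C.kernel`, so `D / C.kernel` is central in `Dis Q / C.kernel`.
It is cyclic, because it embeds in the automorphisms of the Frobenius kernel on one block that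
commute with the irreducible action of `L_a`, and these lie in a finite field. It is nontrivial,
because the condition on `σ_Q` forbids all point stabilisers along a block from being equal.
Together with generation by the elements `y * (φ y)⁻¹`, where `φ` is induced by conjugation with
`L_a`, this makes `Dis Q / C.kernel` extraspecial (`extraspecial_of_irreducible`); the commutator
form then gives that `n` is even.

A point stabiliser in `D` supplies a `q`-element with exactly one fixed point on a block, so `q ∣ p
^ m - 1`. In particular `p ≠ q`, and the extension splits by Schur–Zassenhaus. The rank of
`C.kernel` lies between `m` and `2 * m`, because evaluation at one point is onto its block and
evaluation at points of two blocks is injective. -/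

theorem even_finrank_of_isAlt {F V : Type*} [Field F] [AddCommGroup V] [Module F V]
    [FiniteDimensional F V] (B : LinearMap.BilinForm F V) (hB : B.Nondegenerate)
    (hA : B.IsAlt) : Even (Module.finrank F V) := by
  -- A maximal totally isotropic subspace equals its own orthogonal, since any further orthogonal
  -- vector could be adjoined. The dimension is therefore twice that of `W`.
  obtain ⟨W, hW, hmax⟩ := WellFounded.has_min (wellFounded_gt (α := Submodule F V))
    {W | W ≤ B.orthogonal W} ⟨⊥, show ⊥ ≤ B.orthogonal ⊥ from bot_le⟩
  have hr : B.IsRefl := hA.isRefl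
  have hle : B.orthogonal W ≤ W := by
    intro x hx
    by_contra hxW
    refine hmax (W ⊔ Submodule.span F {x}) ?_ ?_
    · intro y hy z hz
      obtain ⟨w, hw, y', hy', rfl⟩ := Submodule.mem_sup.1 hy
      obtain ⟨v, hv, z', hz', rfl⟩ := Submodule.mem_sup.1 hz
      obtain ⟨s, rfl⟩ := Submodule.mem_span_singleton.1 hy'
      obtain ⟨t, rfl⟩ := Submodule.mem_span_singleton.1 hz'
      have h1 : B v w = 0 := hW hw v hv
      have h2 : B v x = 0 := hx v hv
      have h3 : B x w = 0 := hr _ _ (hx w hw)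
      have h4 : B x x = 0 := hA x
      simp [h1, h2, h3, h4]
    · refine lt_of_le_of_ne le_sup_left fun h => hxW ?_
      rw [h]
      exact Submodule.mem_sup_right (Submodule.mem_span_singleton_self x)
  have hWeq : B.orthogonal W = W := le_antisymm hle hW
  have h := LinearMap.BilinForm.finrank_orthogonal hB W
  rw [hWeq] at h
  have h' := Submodule.finrank_le W
  exact ⟨Module.finrank F W, by omega⟩

theorem commutatorElement_mul_right_of_central {K : Type*} [Group K] {x y z : K}
    (h : ⁅x, z⁆ ∈ Subgroup.center K) : ⁅x, y * z⁆ = ⁅x, y⁆ * ⁅x, z⁆ := by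
  have h1 := (Subgroup.mem_center_iff.1 h) y
  have : ⁅x, y * z⁆ = ⁅x, y⁆ * (y * ⁅x, z⁆ * y⁻¹) := by
    simp only [commutatorElement_def]; group
  rw [this, h1]; group

theorem commutatorElement_mul_left_of_central {K : Type*} [Group K] {x y z : K}
    (h : ⁅y, z⁆ ∈ Subgroup.center K) : ⁅x * y, z⁆ = ⁅x, z⁆ * ⁅y, z⁆ := by
  have h1 := (Subgroup.mem_center_iff.1 h)
  have : ⁅x * y, z⁆ = x * ⁅y, z⁆ * z * x⁻¹ * z⁻¹ := by
    simp only [commutatorElement_def]; group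
  rw [this, h1 x]
  have h2 := h1 (x * z * x⁻¹ * z⁻¹)
  have h3 : ⁅x, z⁆ = x * z * x⁻¹ * z⁻¹ := commutatorElement_def x z
  rw [h3, h2]; group

/-- The commutator as a homomorphism in each variable, for a group of class at most two,
composed with a homomorphism from the centre to a commutative group. -/
def commutatorHom {K C : Type*} [Group K] [CommGroup C]
    (h : ∀ x y : K, ⁅x, y⁆ ∈ Subgroup.center K) (ε : Subgroup.center K →* C) :
    K →* K →* C where
  toFun x :=
    { toFun := fun y => ε ⟨⁅x, y⁆, h x y⟩
      map_one' := by
        rw [← ε.map_one]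
        exact congrArg ε (Subtype.ext (commutatorElement_one_right x))
      map_mul' := fun y z => by
        rw [← ε.map_mul]
        exact congrArg ε (Subtype.ext (commutatorElement_mul_right_of_central (h x z))) }
  map_one' := by
    ext y
    exact (congrArg ε (Subtype.ext (commutatorElement_one_left y))).trans ε.map_one
  map_mul' x y := by
    ext z
    exact (congrArg ε (Subtype.ext (commutatorElement_mul_left_of_central (h y z)))).trans
      (ε.map_mul _ _)

theorem even_of_alternating_pairing {A : Type*} [AddCommGroup A] [Finite A] {q n : ℕ}
    [Fact q.Prime] [Module (ZMod q) A] (hn : Nat.card A = q ^ n) (b : A →+ A →+ ZMod q)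
    (halt : ∀ x, b x x = 0) (hnd : ∀ x, (∀ y, b x y = 0) → x = 0) : Even n := by
  let c : A →+ A →ₗ[ZMod q] ZMod q :=
    { toFun := fun x => AddMonoidHom.toZModLinearMap q (b x)
      map_zero' := by ext y; simp
      map_add' := fun x y => by ext z; simp }
  let B : LinearMap.BilinForm (ZMod q) A := AddMonoidHom.toZModLinearMap q c
  have hAlt : B.IsAlt := halt
  have hB : B.Nondegenerate :=
    (LinearMap.IsRefl.nondegenerate_iff_separatingLeft hAlt.isRefl).2 fun x hx => hnd x hx
  have hfin := even_finrank_of_isAlt B hB hAlt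
  have hcard := Module.natCard_eq_pow_finrank (K := ZMod q) (V := A)
  rw [hn, Nat.card_zmod] at hcard
  rwa [Nat.pow_right_injective (Fact.out : q.Prime).two_le hcard]

/-- The commutator induces an alternating pairing on the abelianization with values in the centre.
Its radical is the image of the centre, which is trivial because the centre is the derived subgroup.
Since the values have order dividing `q`, nondegeneracy also makes the abelianization a vector space
over `ZMod q`. -/
theorem even_of_card_center_eq_prime {K : Type*} [Group K] [Finite K] {q n : ℕ} (hq : q.Prime)
    (hc : Nat.card (Subgroup.center K) = q) (hK : commutator K = Subgroup.center K)
    (hn : (Subgroup.center K).index = q ^ n) : Even n := by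
  have := Fact.mk hq
  have hcen : ∀ x y : K, ⁅x, y⁆ ∈ Subgroup.center K := fun x y => by
    rw [← hK, commutator_def]
    exact Subgroup.commutator_mem_commutator (Subgroup.mem_top x) (Subgroup.mem_top y)
  let ε : Subgroup.center K ≃* Multiplicative (ZMod q) :=
    mulEquivOfPrimeCardEq (p := q) hc (by simp)
  let b : Abelianization K →* Abelianization K →* Multiplicative (ZMod q) :=
    Abelianization.lift
      { toFun := fun x => Abelianization.lift (commutatorHom hcen ε.toMonoidHom x)
        map_one' := by ext; simp
        map_mul' := fun x y => by ext; simp }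
  have hb : ∀ x y : K, b (Abelianization.of x) (Abelianization.of y) =
      ε ⟨⁅x, y⁆, hcen x y⟩ := fun x y => rfl
  have hzq : ∀ z : Multiplicative (ZMod q), z ^ q = 1 := fun z => by
    have h : z ^ Nat.card (Multiplicative (ZMod q)) = 1 := pow_card_eq_one'
    rwa [show Nat.card (Multiplicative (ZMod q)) = q by simp] at h
  have hof : ∀ a : Abelianization K, ∃ x : K, Abelianization.of x = a :=
    QuotientGroup.mk_surjective
  have hbi : ∀ x, (∀ y, b x y = 1) → x = 1 := by
    intro x hx
    obtain ⟨x, rfl⟩ := hof x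
    have hxc : x ∈ Subgroup.center K := by
      rw [Subgroup.mem_center_iff]
      intro y
      have h := hb x y
      rw [hx, eq_comm, map_eq_one_iff ε ε.injective] at h
      exact (commutatorElement_eq_one_iff_mul_comm.1 (congrArg Subtype.val h)).symm
    rw [← hK] at hxc
    exact (QuotientGroup.eq_one_iff x).2 hxc
  have hAq : ∀ x : Abelianization K, x ^ q = 1 := by
    intro x
    apply hbi
    intro y
    rw [map_pow, MonoidHom.pow_apply]
    exact hzq _
  have : Finite (Additive (Abelianization K)) := inferInstanceAs (Finite (K ⧸ commutator K))
  let _ : Module (ZMod q) (Additive (Abelianization K)) := AddCommGroup.zmodModule hAq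
  refine even_of_alternating_pairing (A := Additive (Abelianization K)) (q := q)
    (by rw [← hn, ← hK]; rfl)
    { toFun := fun x => MonoidHom.toAdditiveLeft (b x.toMul)
      map_zero' := by ext y; simp
      map_add' := fun x y => by ext z; simp } ?_ hbi
  intro x
  obtain ⟨x', hx'⟩ := hof x.toMul
  have h : b x.toMul x.toMul = 1 := by
    rw [← hx', hb]
    exact (congrArg ε (Subtype.ext (commutatorElement_self x'))).trans ε.map_one
  exact h

/-- Powers of a product in a group with central commutators. -/
theorem mul_pow_of_central_commutators {K : Type*} [Group K]
    (h : ∀ x y : K, ⁅x, y⁆ ∈ Subgroup.center K) (x y : K) (k : ℕ) :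
    (x * y) ^ k = x ^ k * y ^ k * ⁅y, x⁆ ^ (k.choose 2) := by
  have hc : ∀ w : K, Commute w ⁅y, x⁆ := fun w => Subgroup.mem_center_iff.1 (h y x) w
  have hyx : ∀ k : ℕ, y ^ k * x = x * y ^ k * ⁅y, x⁆ ^ k := by
    intro k
    have e1 : ⁅y ^ k, x⁆ = ⁅y, x⁆ ^ k := by
      induction k with
      | zero => simp
      | succ k ih =>
        rw [pow_succ, commutatorElement_mul_left_of_central (h y x), ih, pow_succ]
    have h2 : Commute (x * y ^ k) (⁅y, x⁆ ^ k) := (hc _).pow_right k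
    rw [h2.eq, ← e1, commutatorElement_def]; group
  induction k with
  | zero => simp
  | succ k ih =>
    rw [pow_succ, ih, Nat.choose_succ_succ, Nat.choose_one_right]
    have h1 : ⁅y, x⁆ ^ (k.choose 2) * (x * y) = x * y * ⁅y, x⁆ ^ (k.choose 2) :=
      (((hc (x * y)).pow_right _).eq).symm
    have h2 : ⁅y, x⁆ ^ k * y = y * ⁅y, x⁆ ^ k := (((hc y).pow_right _).eq).symm
    calc x ^ k * y ^ k * ⁅y, x⁆ ^ (k.choose 2) * (x * y)
        = x ^ k * (y ^ k * x) * y * ⁅y, x⁆ ^ (k.choose 2) := by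
          rw [mul_assoc, h1]; group
      _ = x ^ k * x * y ^ k * (⁅y, x⁆ ^ k * y) * ⁅y, x⁆ ^ (k.choose 2) := by
          rw [hyx]; group
      _ = _ := by rw [h2, pow_succ, pow_succ, pow_add]; group

/-- Central extensions by a cyclic group of an elementary abelian group on which an automorphism
acts irreducibly, generated by the elements `y * (φ y)⁻¹`, are extraspecial. -/
theorem extraspecial_of_irreducible {K : Type*} [Group K] [Finite K] {q n : ℕ} (hq : q.Prime)
    (φ : MulAut K) (Z : Subgroup K) (hZc : Z ≤ Subgroup.center K)
    (hφ : ∀ z ∈ Z, φ z = z)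
    (hgen : Subgroup.closure {x | ∃ y, x = y * (φ y)⁻¹} = ⊤)
    (hpow : ∀ x : K, x ^ q ∈ Z) (hcomm : ∀ x y : K, ⁅x, y⁆ ∈ Z)
    (hirr : ∀ S : Subgroup K, Z ≤ S → (∀ x ∈ S, φ x ∈ S) → S = Z ∨ S = ⊤)
    (hcyc : ∃ c ∈ Z, ∀ z ∈ Z, ∃ k : ℤ, z = c ^ k) (hne : Z ≠ ⊥) (hidx : Z.index = q ^ n) :
    IsExtraspecial q K ∧ (Odd q → Monoid.exponent K = q) ∧ Even n ∧
      Nat.card K = q ^ (n + 1) := by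
  have := Fact.mk hq
  have hcen : ∀ x y : K, ⁅x, y⁆ ∈ Subgroup.center K := fun x y => hZc (hcomm x y)
  have hcq : ∀ x y : K, ⁅x, y⁆ ^ q = 1 := by
    intro x y
    have e1 : ⁅x ^ q, y⁆ = ⁅x, y⁆ ^ q := by
      generalize q = k
      induction k with
      | zero => simp
      | succ k ih =>
        rw [pow_succ, commutatorElement_mul_left_of_central (hcen x y), ih, pow_succ]
    rw [← e1, commutatorElement_eq_one_iff_mul_comm]
    exact ((Subgroup.mem_center_iff.1 (hZc (hpow x))) y).symm
  have hK'Z : commutator K ≤ Z := by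
    rw [commutator_def, Subgroup.commutator_le]
    exact fun x _ y _ => hcomm x y
  have hK'q : ∀ z ∈ commutator K, z ^ q = 1 := by
    intro z hz
    rw [commutator_eq_closure] at hz
    have : z ∈ Subgroup.center K ∧ z ^ q = 1 := by
      induction hz using Subgroup.closure_induction with
      | mem x hx =>
        obtain ⟨a, b, rfl⟩ := hx
        exact ⟨hcen a b, hcq a b⟩
      | one => exact ⟨one_mem _, one_pow _⟩
      | mul x y _ _ hx hy =>
        refine ⟨mul_mem hx.1 hy.1, ?_⟩
        have hc : Commute x y := Subgroup.mem_center_iff.1 hy.1 x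
        rw [hc.mul_pow, hx.2, hy.2, one_mul]
      | inv x _ hx => exact ⟨inv_mem hx.1, by rw [inv_pow, hx.2, inv_one]⟩
    exact this.2
  -- On the finite abelianization, `x ↦ x * (φ x)⁻¹` is onto by `hgen`, hence injective. It kills
  -- the image of `Z`, so that image is trivial.
  have hZK' : Z ≤ commutator K := by
    let A := Abelianization K
    let ψ : A →* A := Abelianization.map φ.toMonoidHom
    let δ : A →* A := MonoidHom.id A * ψ⁻¹
    have hδ : ∀ x : K, δ (Abelianization.of x) = Abelianization.of (x * (φ x)⁻¹) := by
      intro x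
      simp only [δ, ψ, MonoidHom.mul_apply, MonoidHom.inv_apply, map_mul, map_inv]
      rfl
    have : Finite A := inferInstanceAs (Finite (K ⧸ commutator K))
    have hsurj : Function.Surjective δ := by
      have : (⊤ : Subgroup K) ≤ δ.range.comap Abelianization.of := by
        rw [← hgen, Subgroup.closure_le]
        rintro _ ⟨y, rfl⟩
        exact ⟨Abelianization.of y, hδ y⟩
      intro a
      obtain ⟨x, rfl⟩ := QuotientGroup.mk_surjective a
      exact this (Subgroup.mem_top x)
    have hinj : Function.Injective δ := Finite.injective_iff_surjective.2 hsurj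
    intro z hz
    have h1 : δ (Abelianization.of z) = 1 := by rw [hδ, hφ z hz]; simp
    have h2 : Abelianization.of z = 1 := hinj (by rw [h1, map_one])
    exact (QuotientGroup.eq_one_iff z).1 h2
  have hZ' : commutator K = Z := le_antisymm hK'Z hZK'
  have hZq : ∀ z ∈ Z, z ^ q = 1 := fun z hz => hK'q z (hZK' hz)
  have hcardZ : Nat.card Z = q := by
    obtain ⟨c, hc, hgenc⟩ := hcyc
    have hZc' : Z = Subgroup.zpowers c := by
      refine le_antisymm (fun z hz => ?_) (by simpa using hc)
      obtain ⟨k, rfl⟩ := hgenc z hz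
      exact ⟨k, rfl⟩
    have hc1 : c ≠ 1 := by
      rintro rfl
      exact hne (by rw [hZc']; simp)
    rw [hZc', Nat.card_zpowers]
    exact orderOf_eq_prime (hZq c hc) hc1
  -- The centre is `φ`-invariant, so irreducibility leaves only `Z` or the whole group; the latter
  -- would make `commutator K = Z` trivial.
  have hcenZ : Subgroup.center K = Z := by
    refine (hirr _ hZc fun x hx => ?_).resolve_right fun h => hne ?_
    · rw [Subgroup.mem_center_iff] at hx ⊢
      intro y
      obtain ⟨y, rfl⟩ := φ.surjective y
      rw [← map_mul, ← map_mul, hx]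
    · rw [← hZ', commutator_def, Subgroup.commutator_eq_bot_iff_le_centralizer,
        Subgroup.coe_top, Subgroup.centralizer_univ, h]
  have hcard : Nat.card K = q ^ (n + 1) := by
    rw [← Subgroup.card_mul_index Z, hcardZ, hidx, pow_succ, mul_comm]
  -- For odd `q` the binomial coefficient `q.choose 2` is divisible by `q`, so taking `q`-th powers
  -- is a homomorphism. It kills each generator `y * (φ y)⁻¹`, because `y ^ q` lies in `Z` and is
  -- fixed by `φ`.
  have hexp : Odd q → ∀ x : K, x ^ q = 1 := by
    intro hodd
    have hmul : ∀ x y : K, (x * y) ^ q = x ^ q * y ^ q := by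
      intro x y
      have hd : q ∣ q.choose 2 := hq.dvd_choose_self two_ne_zero
        (lt_of_le_of_ne hq.two_le fun h => by rw [← h] at hodd; exact absurd hodd (by decide))
      obtain ⟨k, hk⟩ := hd
      rw [mul_pow_of_central_commutators hcen, hk, pow_mul, hcq, one_pow, mul_one]
    intro x
    have hx : x ∈ Subgroup.closure {x | ∃ y, x = y * (φ y)⁻¹} := by rw [hgen]; trivial
    induction hx using Subgroup.closure_induction with
    | mem x hx =>
      obtain ⟨y, rfl⟩ := hx
      rw [hmul, inv_pow, ← map_pow, hφ _ (hpow y), mul_inv_cancel]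
    | one => exact one_pow _
    | mul x y _ _ hx hy => rw [hmul, hx, hy, one_mul]
    | inv x _ hx => rw [inv_pow, hx, inv_one]
  have : Nontrivial K := by
    obtain ⟨z, hz1⟩ := Subgroup.ne_bot_iff_exists_ne_one.1 hne
    exact ⟨z, 1, fun h => hz1 (Subtype.ext h)⟩
  refine ⟨⟨inferInstance, IsPGroup.of_card hcard, by rw [hcenZ, hcardZ], by rw [hcenZ, hZ'], ?_⟩,
    ?_, ?_, hcard⟩
  · rw [hcenZ]
    -- If a maximal subgroup `M` missed part of `Z`, then `M` and the central `Z` would generate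
    -- `K`. All commutators would then come from `M`, putting `Z = commutator K` inside `M`.
    have hle : Z ≤ frattini K := by
      refine le_iInf₂ fun M (hM : IsCoatom M) => ?_
      by_contra hZM
      have htop : M ⊔ Z = ⊤ := hM.2 _ (by
        refine lt_of_le_of_ne le_sup_left fun h => hZM ?_
        rw [h]; exact le_sup_right)
      refine hZM (hZK'.trans ?_)
      rw [commutator_def, Subgroup.commutator_le]
      have : Z.Normal := hcenZ ▸ inferInstance
      intro x _ y _
      have hx : x ∈ M ⊔ Z := by rw [htop]; trivial
      have hy : y ∈ M ⊔ Z := by rw [htop]; trivial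
      obtain ⟨a, ha, z, hz, rfl⟩ := Subgroup.mem_sup_of_normal_right.1 hx
      obtain ⟨b, hb, w, hw, rfl⟩ := Subgroup.mem_sup_of_normal_right.1 hy
      have hz1 : ∀ u : K, ⁅z, u⁆ = 1 := fun u => commutatorElement_eq_one_iff_mul_comm.2
        (Subgroup.mem_center_iff.1 (hZc hz) u).symm
      have hw1 : ∀ u : K, ⁅u, w⁆ = 1 := fun u => commutatorElement_eq_one_iff_mul_comm.2
        (Subgroup.mem_center_iff.1 (hZc hw) u)
      rw [commutatorElement_mul_left_of_central (hcen _ _), hz1, mul_one,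
        commutatorElement_mul_right_of_central (hcen _ _), hw1, mul_one, commutatorElement_def]
      exact mul_mem (mul_mem (mul_mem ha hb) (inv_mem ha)) (inv_mem hb)
    refine (hirr _ hle fun x hx => ?_).resolve_right ?_
    · have := (Subgroup.characteristic_iff_map_le.1 (inferInstance :
        (frattini K).Characteristic)) φ
      exact this ⟨x, hx, rfl⟩
    · obtain ⟨M, hM, -⟩ := (eq_top_or_exists_le_coatom (⊥ : Subgroup K)).resolve_left bot_ne_top
      exact fun h => hM.1 (top_le_iff.1 (h ▸ frattini_le_coatom hM))
  · intro hodd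
    refine ((Nat.dvd_prime hq).1 (Monoid.exponent_dvd_of_forall_pow_eq_one
      (hexp hodd))).resolve_left fun h => ?_
    exact not_subsingleton K (Monoid.exp_eq_one_iff.1 h)
  · exact even_of_card_center_eq_prime hq (by rw [hcenZ, hcardZ]) (by rw [hZ', hcenZ])
      (by rw [hcenZ, hidx])

/-! ### Automorphisms and strictly simple quandles -/

/-- The group of automorphisms of a quandle. -/
def autGroup (R : Type*) [Quandle R] : Subgroup (Equiv.Perm R) where
  carrier := {g | ∀ x y : R, g (x ◃ y) = g x ◃ g y}
  one_mem' := fun _ _ => rfl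
  mul_mem' := fun {g h} hg hh x y => by
    rw [Equiv.Perm.mul_apply, hh, hg]; rfl
  inv_mem' := fun {g} hg x y => by
    apply g.injective
    rw [hg]; simp

section Aut

variable {R : Type*} [Quandle R]

theorem autGroup.map_act {g : Equiv.Perm R} (hg : g ∈ autGroup R) (x y : R) :
    g (x ◃ y) = g x ◃ g y := hg x y

theorem autGroup.conj_act {g : Equiv.Perm R} (hg : g ∈ autGroup R) (x : R) :
    g * Rack.act' x * g⁻¹ = Rack.act' (g x) := by
  ext y
  simp [autGroup.map_act hg]

theorem autGroup.map_invAct {g : Equiv.Perm R} (hg : g ∈ autGroup R) (x y : R) :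
    g (x ◃⁻¹ y) = g x ◃⁻¹ g y := by
  apply (Rack.act' (g x)).injective
  simp [← autGroup.map_act hg]

theorem act_mem_autGroup (x : R) : Rack.act' x ∈ autGroup R :=
  fun _ _ => Shelf.self_distrib

theorem act_self (x : R) : Rack.act' x x = x := Quandle.fix

theorem act_inv_self (x : R) : (Rack.act' x)⁻¹ x = x := by
  rw [Equiv.Perm.inv_eq_iff_eq, act_self]

/-- The elements fixed by an automorphism form a subquandle. -/
def fixSubquandle (g : Equiv.Perm R) (hg : g ∈ autGroup R) : Subquandle R where
  carrier := {x | g x = x}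
  act_mem := fun {a b} (ha : g a = a) (hb : g b = b) => by
    change g (a ◃ b) = a ◃ b
    rw [autGroup.map_act hg, ha, hb]
  invAct_mem := fun {a b} (ha : g a = a) (hb : g b = b) => by
    change g (a ◃⁻¹ b) = a ◃⁻¹ b
    rw [autGroup.map_invAct hg, ha, hb]

/-- The orbit of `a` under a group of automorphisms normalised by `L_a` is a subquandle. -/
def orbitSubquandle (S : Subgroup (Equiv.Perm R)) (hS : S ≤ autGroup R) (a : R)
    (h : ∀ s, s ∈ S ↔ Rack.act' a * s * (Rack.act' a)⁻¹ ∈ S) : Subquandle R where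
  carrier := {x | ∃ s ∈ S, s a = x}
  act_mem := by
    rintro _ _ ⟨s, hs, rfl⟩ ⟨t, ht, rfl⟩
    refine ⟨s * (Rack.act' a * (s⁻¹ * t) * (Rack.act' a)⁻¹),
      mul_mem hs ((h _).1 (mul_mem (inv_mem hs) ht)), ?_⟩
    have h1 := autGroup.conj_act (hS hs) a
    have : s a ◃ t a = Rack.act' (s a) (t a) := rfl
    rw [this, ← h1]
    simp only [Equiv.Perm.mul_apply, act_inv_self]
  invAct_mem := by
    rintro _ _ ⟨s, hs, rfl⟩ ⟨t, ht, rfl⟩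
    refine ⟨s * ((Rack.act' a)⁻¹ * (s⁻¹ * t) * (Rack.act' a)),
      mul_mem hs ((h _).2 (by
        have : Rack.act' a * ((Rack.act' a)⁻¹ * (s⁻¹ * t) * Rack.act' a) * (Rack.act' a)⁻¹ =
          s⁻¹ * t := by group
        rw [this]
        exact mul_mem (inv_mem hs) ht)), ?_⟩
    have h1 := autGroup.conj_act (hS hs) a
    have : s a ◃⁻¹ t a = (Rack.act' (s a))⁻¹ (t a) := rfl
    rw [this, ← h1]
    simp only [Equiv.Perm.mul_apply, act_self, mul_inv_rev, inv_inv]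

theorem IsStrictlySimple.carrier_eq_univ (hR : IsStrictlySimple R) (S : Subquandle R)
    {x y : R} (hx : x ∈ S.carrier) (hy : y ∈ S.carrier) (hxy : x ≠ y) :
    S.carrier = Set.univ := by
  by_contra h
  exact hR S ⟨h, x, hx, y, hy, hxy⟩

/-- The fixed points form a subquandle with at least two elements. This is the source of the
Frobenius condition on all the permutation groups below. -/
theorem IsStrictlySimple.eq_one_of_fix (hR : IsStrictlySimple R) {g : Equiv.Perm R}
    (hg : g ∈ autGroup R) {x y : R} (hxy : x ≠ y) (hx : g x = x) (hy : g y = y) : g = 1 := by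
  have := hR.carrier_eq_univ (fixSubquandle g hg) hx hy hxy
  ext z
  have hz : z ∈ (fixSubquandle g hg).carrier := by rw [this]; trivial
  exact hz

/-- A nontrivial group of automorphisms normalised by `L_a` which moves `a` is transitive. -/
theorem IsStrictlySimple.exists_apply_eq (hR : IsStrictlySimple R)
    {S : Subgroup (Equiv.Perm R)} (hS : S ≤ autGroup R) {a : R}
    (h : ∀ s, s ∈ S ↔ Rack.act' a * s * (Rack.act' a)⁻¹ ∈ S) {s : Equiv.Perm R} (hs : s ∈ S)
    (hsa : s a ≠ a) (x : R) : ∃ t ∈ S, t a = x := by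
  have := hR.carrier_eq_univ (orbitSubquandle S hS a h) ⟨1, one_mem S, rfl⟩ ⟨s, hs, rfl⟩ hsa.symm
  have hx : x ∈ (orbitSubquandle S hS a h).carrier := by rw [this]; trivial
  exact hx

end Aut

/-! ### Frobenius groups of prime power degree -/

section Frobenius

variable {X : Type*} [Finite X] {p m : ℕ}

theorem card_modEq_one_of_fix (hp : p.Prime) {g : Equiv.Perm X} {j : ℕ} (hg : g ^ p ^ j = 1)
    {x : X} (hx : g x = x) (hsemi : ∀ y, g y = y → y = x) : Nat.card X ≡ 1 [MOD p] := by
  classical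
  have := Fact.mk hp
  have := Fintype.ofFinite X
  let f : Function.End X := (g : X → X)
  have hfix := Equiv.Perm.card_fixedPoints_modEq (f := f) (p := p) (n := j) (by
    have h : ∀ k : ℕ, f ^ k = ((g ^ k : Equiv.Perm X) : X → X) := by
      intro k
      induction k with
      | zero => rfl
      | succ k ih => rw [pow_succ, ih, pow_succ]; rfl
    rw [h, hg]; rfl)
  have h1 : Fintype.card (Function.fixedPoints (g : X → X)) = 1 := by
    rw [Fintype.card_eq_one_iff]
    exact ⟨⟨x, hx⟩, fun y => Subtype.ext (hsemi y.1 y.2)⟩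
  rw [← Nat.card_eq_fintype_card] at hfix
  rw [← h1]
  exact hfix

/-- A nontrivial such `g` would have exactly one fixed point, and orbit counting would make the
degree `p ^ m` congruent to `1` modulo `p`. -/
theorem eq_one_of_pow_eq_one_of_fix (hp : p.Prime) (hX : Nat.card X = p ^ m)
    {g : Equiv.Perm X} {j : ℕ} (hg : g ^ p ^ j = 1) {x : X} (hx : g x = x)
    (hsemi : ∀ y, g y = y → y ≠ x → g = 1) : g = 1 := by
  by_contra hne
  have h2 := card_modEq_one_of_fix hp hg hx fun y hy => by
    by_contra h
    exact hne (hsemi y hy h)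
  rw [hX] at h2
  rcases Nat.eq_zero_or_pos m with rfl | hm
  · rw [pow_zero, Nat.card_eq_one_iff_unique] at hX
    have := hX.1
    exact hne (Subsingleton.elim _ _)
  · have h3 : p ∣ p ^ m := dvd_pow_self p hm.ne'
    have h4 : 1 ≡ 0 [MOD p] := h2.symm.trans ((Nat.modEq_zero_iff_dvd).2 h3)
    exact hp.one_lt.ne' (Nat.dvd_one.1 ((Nat.modEq_zero_iff_dvd).1 h4))

/-- The kernel of a Frobenius group of prime power degree. -/
theorem exists_frobenius_kernel (hp : p.Prime) (hX : Nat.card X = p ^ m)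
    (M : Subgroup (Equiv.Perm X)) (htrans : ∀ x y, ∃ g ∈ M, g x = y)
    (hsemi : ∀ g ∈ M, ∀ x y, x ≠ y → g x = x → g y = y → g = 1) :
    ∃ P : Subgroup (Equiv.Perm X), P ≤ M ∧ Nat.card P = p ^ m ∧
      (∀ g ∈ M, g ∈ P ↔ g = 1 ∨ ∀ x, g x ≠ x) := by
  classical
  have := Fact.mk hp
  have hpos : 0 < Nat.card X := by rw [hX]; exact pow_pos hp.pos m
  obtain ⟨hne, -⟩ := Nat.card_pos_iff.1 hpos
  obtain ⟨x₀⟩ := hne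
  have hpt : MulAction.IsPretransitive M X := ⟨fun x y => by
    obtain ⟨g, hg, h⟩ := htrans x y
    exact ⟨⟨g, hg⟩, h⟩⟩
  have hdvd : p ^ m ∣ Nat.card M := by
    rw [← hX, ← MulAction.index_stabilizer_of_transitive M x₀]
    exact Subgroup.index_dvd_card _
  obtain ⟨P₀, hP₀⟩ := Sylow.exists_subgroup_card_pow_prime p hdvd
  let P := P₀.map M.subtype
  have hPcard : Nat.card P = p ^ m := by
    rw [← hP₀]
    exact Nat.card_congr (P₀.equivMapOfInjective M.subtype M.subtype_injective).symm.toEquiv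
  have hPM : P ≤ M := Subgroup.map_subtype_le P₀
  have hPF : ∀ g ∈ P, g = 1 ∨ ∀ x, g x ≠ x := by
    intro g hg
    by_cases h : ∃ x, g x = x
    · obtain ⟨x, hx⟩ := h
      refine Or.inl (eq_one_of_pow_eq_one_of_fix hp hX (j := m) ?_ hx fun y hy hyx =>
        hsemi g (hPM hg) y x hyx hy hx)
      rw [← hPcard]
      exact congrArg Subtype.val (pow_card_eq_one' (x := (⟨g, hg⟩ : P)))
    · exact Or.inr (not_exists.1 h)
  have := Fintype.ofFinite X
  have := Fintype.ofFinite M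
  -- Burnside's count replaces Frobenius' theorem: it shows that the identity and the
  -- fixed-point-free elements together number exactly `p ^ m`. The `p`-subgroup of that order
  -- consists of such elements, so it contains all of them.
  have hburn := MulAction.sum_card_fixedBy_eq_card_orbits_mul_card_group M X
  have horb : Fintype.card (Quotient (MulAction.orbitRel M X)) = 1 := by
    rw [Fintype.card_eq_one_iff]
    refine ⟨Quotient.mk _ x₀, fun y => ?_⟩
    induction y using Quotient.inductionOn with
    | h y => exact Quotient.sound (MulAction.exists_smul_eq M x₀ y)
  rw [horb, one_mul] at hburn
  let F : Finset M := Finset.univ.filter fun g => g = 1 ∨ ∀ x, (g : Equiv.Perm X) x ≠ x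
  have hpoint : ∀ g : M, Fintype.card (MulAction.fixedBy X g) + (if g ∈ F then 1 else 0) =
      1 + if g = 1 then p ^ m else 0 := by
    intro g
    by_cases h1 : g = 1
    · subst h1
      have : Fintype.card (MulAction.fixedBy X (1 : M)) = p ^ m := by
        rw [← hX, ← Nat.card_eq_fintype_card, MulAction.fixedBy_one_eq_univ]
        exact Nat.card_congr (Equiv.Set.univ X)
      rw [this]
      simp [F, add_comm]
    · by_cases h2 : ∀ x, (g : Equiv.Perm X) x ≠ x
      · have : Fintype.card (MulAction.fixedBy X g) = 0 := by
          rw [Fintype.card_eq_zero_iff]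
          exact ⟨fun x => h2 x.1 x.2⟩
        have hF : g ∈ F := by
          simp only [F, Finset.mem_filter, Finset.mem_univ, true_and]
          exact Or.inr h2
        rw [this, if_pos hF, if_neg h1]
      · have hF : g ∉ F := by
          simp only [F, Finset.mem_filter, Finset.mem_univ, true_and]
          exact fun h => h.elim h1 h2
        push Not at h2
        obtain ⟨x, hx⟩ := h2
        have : Fintype.card (MulAction.fixedBy X g) = 1 := by
          rw [Fintype.card_eq_one_iff]
          refine ⟨⟨x, hx⟩, fun y => ?_⟩
          by_contra hy
          exact h1 (Subtype.ext (hsemi g g.2 y x (fun h => hy (Subtype.ext h)) y.2 hx))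
        rw [this, if_neg hF, if_neg h1]
  have hsum := Finset.sum_congr (rfl : (Finset.univ : Finset M) = Finset.univ)
    fun g _ => hpoint g
  rw [Finset.sum_add_distrib, hburn, Finset.sum_add_distrib] at hsum
  simp only [Finset.sum_ite_mem, Finset.univ_inter, Finset.sum_const, smul_eq_mul, mul_one,
    Finset.card_univ, Finset.sum_ite_eq', Finset.mem_univ, if_true, add_right_inj] at hsum
  have hFP : (P₀ : Set M) = (F : Set M) := by
    refine Set.eq_of_subset_of_ncard_le (fun g hg => ?_) ?_ (Set.toFinite _)
    · simp only [F, Finset.coe_filter, Finset.mem_univ, true_and, Set.mem_ofPred_eq]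
      exact (hPF g ⟨g, hg, rfl⟩).imp_left fun h => Subtype.ext h
    · rw [Set.ncard_coe_finset, hsum, ← hP₀]; exact (Nat.card_coe_set_eq _).le
  refine ⟨P, hPM, hPcard, fun g hg => ⟨hPF g, fun h => ?_⟩⟩
  have hgF : (⟨g, hg⟩ : M) ∈ (F : Set M) := by
    simp only [F, Finset.coe_filter, Finset.mem_univ, true_and, Set.mem_ofPred_eq]
    exact h.imp_left fun h => Subtype.ext h
  rw [← hFP] at hgF
  exact ⟨_, hgF, rfl⟩

theorem exists_apply_eq_of_card {P : Subgroup (Equiv.Perm X)} (hP : Nat.card P = Nat.card X)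
    (h : ∀ g ∈ P, g = 1 ∨ ∀ x, g x ≠ x) (x y : X) : ∃ g ∈ P, g x = y := by
  have hinj : Function.Injective fun g : P => (g : Equiv.Perm X) x := by
    intro g k hgk
    have h1 : (g⁻¹ * k : P).1 x = x := by
      have : (g : Equiv.Perm X) x = (k : Equiv.Perm X) x := hgk
      simp [← this]
    have h2 := (h _ (g⁻¹ * k : P).2).resolve_right fun h => h x h1
    exact inv_mul_eq_one.1 (Subtype.ext h2)
  have hbij := (Nat.bijective_iff_injective_and_card _).2 ⟨hinj, hP⟩
  obtain ⟨g, hg⟩ := hbij.2 y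
  exact ⟨g, g.2, hg⟩

end Frobenius

/-- By finiteness, a conjugate of `S` contained in `S` is all of `S`. -/
theorem conj_mem_iff_of_conj_mem {X : Type*} [Finite X] {S : Subgroup (Equiv.Perm X)}
    {f : Equiv.Perm X} (h : ∀ s ∈ S, f * s * f⁻¹ ∈ S) (s : Equiv.Perm X) :
    s ∈ S ↔ f * s * f⁻¹ ∈ S := by
  refine ⟨h s, fun hs => ?_⟩
  have hmap : S.map (MulAut.conj f).toMonoidHom ≤ S := by
    rintro _ ⟨t, ht, rfl⟩
    exact h t ht
  have heq : S.map (MulAut.conj f).toMonoidHom = S :=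
    Subgroup.eq_of_le_of_card_ge hmap (le_of_eq
      (Nat.card_congr (S.equivMapOfInjective _ (MulAut.conj f).injective).toEquiv))
  rw [← heq] at hs
  obtain ⟨t, ht, hts⟩ := hs
  have : t = s := (MulAut.conj f).injective hts
  exact this ▸ ht

/-- A transitive automorphism group of a strictly simple quandle of prime power order, normalised
by some `L_a`, has a regular elementary abelian subgroup consisting of the identity and the
fixed-point-free elements, on which `L_a` acts irreducibly. -/
theorem IsStrictlySimple.exists_regular {R : Type*} [Quandle R] [Finite R] {p m : ℕ}
    (hp : p.Prime) (hR : IsStrictlySimple R) (hcard : Nat.card R = p ^ m)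
    (M : Subgroup (Equiv.Perm R)) (hM : M ≤ autGroup R) (htrans : ∀ x y, ∃ g ∈ M, g x = y)
    (a : R) (hnorm : ∀ g ∈ M, Rack.act' a * g * (Rack.act' a)⁻¹ ∈ M) :
    ∃ P : Subgroup (Equiv.Perm R), P ≤ M ∧ Nat.card P = p ^ m ∧
      (∀ g ∈ M, g ∈ P ↔ g = 1 ∨ ∀ x, g x ≠ x) ∧ (∀ x y, ∃ g ∈ P, g x = y) ∧
      (∀ g ∈ P, ∀ h ∈ P, g * h = h * g) ∧ (∀ g ∈ P, g ^ p = 1) ∧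
      (∀ S ≤ P, (∀ s ∈ S, Rack.act' a * s * (Rack.act' a)⁻¹ ∈ S) → S = ⊥ ∨ S = P) ∧
      (∀ g ∈ P, Rack.act' a * g * (Rack.act' a)⁻¹ ∈ P) ∧
      (∀ g ∈ M, ∀ j : ℕ, g ^ p ^ j = 1 → g ∈ P) := by
  have := Fact.mk hp
  obtain ⟨P, hPM, hPcard, hPchar⟩ := exists_frobenius_kernel hp hcard M htrans
    fun g hg x y hxy hx hy => hR.eq_one_of_fix (hM hg) hxy hx hy
  have hPf : ∀ g ∈ P, g = 1 ∨ ∀ x, g x ≠ x := fun g hg => (hPchar g (hPM hg)).1 hg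
  have hPnorm : ∀ g ∈ P, Rack.act' a * g * (Rack.act' a)⁻¹ ∈ P := by
    intro g hg
    rw [hPchar _ (hnorm g (hPM hg))]
    refine (hPf g hg).imp (fun h => by rw [h]; group) fun h x hx => h ((Rack.act' a)⁻¹ x) ?_
    exact Equiv.Perm.eq_inv_iff_eq.2 hx
  -- The orbit of `a` under a nontrivial invariant `S` is a subquandle with more than one element,
  -- hence everything. So `S` is already transitive, and it fills the regular group `P`.
  have hirr : ∀ S ≤ P, (∀ s ∈ S, Rack.act' a * s * (Rack.act' a)⁻¹ ∈ S) → S = ⊥ ∨ S = P := by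
    intro S hSP hS
    refine or_iff_not_imp_left.2 fun hne => le_antisymm hSP fun g hg => ?_
    obtain ⟨⟨s, hs⟩, hs1⟩ := Subgroup.ne_bot_iff_exists_ne_one.1 hne
    have hsa : s a ≠ a := (hPf s (hSP hs)).resolve_left (fun h => hs1 (Subtype.ext h)) a
    obtain ⟨t, ht, hta⟩ := hR.exists_apply_eq (hSP.trans (hPM.trans hM))
      (conj_mem_iff_of_conj_mem hS) hs hsa (g a)
    have h1 : (g⁻¹ * t) a = a := by simp [hta]
    have h2 := (hPf (g⁻¹ * t) (mul_mem (inv_mem hg) (hSP ht))).resolve_right fun h => h a h1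
    rw [inv_mul_eq_one.1 h2]
    exact ht
  -- The centre of the `p`-group `P` is invariant and nontrivial unless `P` is, so irreducibility
  -- makes it all of `P`. The same argument with the elements `g ^ p = 1` gives exponent `p` below.
  have hcomm : ∀ g ∈ P, ∀ h ∈ P, g * h = h * g := by
    let Z := (Subgroup.center P).map P.subtype
    have hZ : ∀ z, z ∈ Z ↔ z ∈ P ∧ ∀ g ∈ P, g * z = z * g := by
      intro z
      constructor
      · rintro ⟨z, hz, rfl⟩
        exact ⟨z.2, fun g hg => congrArg Subtype.val (Subgroup.mem_center_iff.1 hz ⟨g, hg⟩)⟩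
      · rintro ⟨hz, h⟩
        exact ⟨⟨z, hz⟩, Subgroup.mem_center_iff.2 fun g => Subtype.ext (h g.1 g.2), rfl⟩
    rcases hirr Z (fun z hz => ((hZ z).1 hz).1) (fun z hz => by
      rw [hZ] at hz ⊢
      refine ⟨hPnorm z hz.1, fun g hg => ?_⟩
      have h1 : (Rack.act' a)⁻¹ * g * Rack.act' a ∈ P := by
        rw [conj_mem_iff_of_conj_mem hPnorm]
        convert hg using 1; group
      have h2 := hz.2 _ h1
      calc g * (Rack.act' a * z * (Rack.act' a)⁻¹)
          = Rack.act' a * ((Rack.act' a)⁻¹ * g * Rack.act' a * z) * (Rack.act' a)⁻¹ := by group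
        _ = _ := by rw [h2]; group) with h | h
    · have hPbot : P = ⊥ := by
        by_contra hne
        have : Nontrivial P := (Subgroup.nontrivial_iff_ne_bot P).2 hne
        have hpg : IsPGroup p P := IsPGroup.of_card hPcard
        have := hpg.center_nontrivial
        obtain ⟨z, hz⟩ := exists_ne (1 : Subgroup.center P)
        have : (z : P).1 ∈ Z := ⟨z, z.2, rfl⟩
        rw [h, Subgroup.mem_bot] at this
        exact hz (Subtype.ext (Subtype.ext this))
      intro g hg k hk
      rw [hPbot, Subgroup.mem_bot] at hg hk
      rw [hg, hk]
    · intro g hg k hk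
      rw [← h] at hk
      exact ((hZ k).1 hk).2 g hg
  refine ⟨P, hPM, hPcard, hPchar, exists_apply_eq_of_card (hPcard.trans hcard.symm) hPf, hcomm,
    ?_, hirr, hPnorm, fun g hg j hj => (hPchar g hg).2 (or_iff_not_imp_right.2 fun h => ?_)⟩
  swap
  · push Not at h
    obtain ⟨x, hx⟩ := h
    exact eq_one_of_pow_eq_one_of_fix hp hcard hj hx fun y hy hyx =>
      hR.eq_one_of_fix (hM hg) hyx hy hx
  let Ω : Subgroup (Equiv.Perm R) :=
    { carrier := {g | g ∈ P ∧ g ^ p = 1}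
      one_mem' := ⟨one_mem P, one_pow p⟩
      mul_mem' := fun {g k} hg hk => ⟨mul_mem hg.1 hk.1, by
        have hc : Commute g k := hcomm g hg.1 k hk.1
        rw [hc.mul_pow, hg.2, hk.2, one_mul]⟩
      inv_mem' := fun {g} hg => ⟨inv_mem hg.1, by rw [inv_pow, hg.2, inv_one]⟩ }
  rcases hirr Ω (fun g hg => hg.1) (fun g hg => ⟨hPnorm g hg.1, by
    rw [conj_pow, hg.2]; group⟩) with h | h
  · have hPbot : P = ⊥ := by
      by_contra hne
      have hnt : Nontrivial P := (Subgroup.nontrivial_iff_ne_bot P).2 hne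
      have hdvd : p ∣ Nat.card P := by
        rw [hPcard]
        refine dvd_pow_self p fun hm => ?_
        rw [hm, pow_zero] at hPcard
        exact hne ((Subgroup.card_eq_one).1 hPcard)
      obtain ⟨g, hg⟩ := exists_prime_orderOf_dvd_card' p hdvd
      have hgΩ : g.1 ∈ Ω := ⟨g.2, by
        have := pow_orderOf_eq_one g
        rw [hg] at this
        exact congrArg Subtype.val this⟩
      rw [h, Subgroup.mem_bot] at hgΩ
      have : g = 1 := Subtype.ext hgΩ
      rw [this, orderOf_one] at hg
      exact hp.one_lt.ne hg
    intro g hg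
    rw [hPbot, Subgroup.mem_bot] at hg
    rw [hg, one_pow]
  · intro g hg
    rw [← h] at hg
    exact hg.2

/-- A transitive group of automorphisms normalised by some `L_a` contains the displacements. -/
theorem act_mul_act_inv_mem {R : Type*} [Quandle R] {P : Subgroup (Equiv.Perm R)}
    (hP : P ≤ autGroup R) {a : R} (htrans : ∀ y, ∃ g ∈ P, g a = y)
    (hnorm : ∀ g ∈ P, Rack.act' a * g * (Rack.act' a)⁻¹ ∈ P) (b c : R) :
    Rack.act' b * (Rack.act' c)⁻¹ ∈ P := by
  have h : ∀ b, Rack.act' b * (Rack.act' a)⁻¹ ∈ P := by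
    intro b
    obtain ⟨g, hg, rfl⟩ := htrans b
    rw [← autGroup.conj_act (hP hg)]
    have := mul_mem hg (hnorm _ (inv_mem hg))
    convert this using 1; group
  have := mul_mem (h b) (inv_mem (h c))
  convert this using 1; group

/-! ### Automorphisms commuting with an irreducible endomorphism -/

/-- A group of automorphisms of a finite commutative group commuting with an endomorphism that
acts irreducibly is cyclic. -/
theorem isCyclic_range_of_irreducible {A N : Type*} [CommGroup A] [Finite A] [Nontrivial A]
    [Group N] (f : A →* A) (ψ : N →* MulAut A) (hψ : ∀ n a, ψ n (f a) = f (ψ n a))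
    (hirr : ∀ S : Subgroup A, (∀ s ∈ S, f s ∈ S) → S = ⊥ ∨ S = ⊤) : IsCyclic ψ.range := by
  let F : AddMonoid.End (Additive A) := MonoidHom.toAdditive f
  -- Schur's lemma: kernels of elements of `D` are `f`-invariant, so `D` is a finite domain, hence a
  -- field by Wedderburn. The group in question embeds multiplicatively in that field and is
  -- therefore cyclic.
  let D := Subring.centralizer {F}
  have hD : ∀ d : D, ∀ a : Additive A, d.1 (F a) = F (d.1 a) := fun d a => by
    have h := Subring.mem_centralizer_iff.1 d.2 F rfl
    exact (DFunLike.congr_fun h a).symm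
  have hinj : ∀ d : D, d ≠ 0 → ∀ a, d.1 a = 0 → a = 0 := by
    intro d hd a ha
    let S : Subgroup A := (AddMonoidHom.toMultiplicative (α := Additive A) (β := Additive A)
      d.1).ker
    have hS : ∀ x : A, x ∈ S ↔ d.1 (Additive.ofMul x) = 0 := fun x => Iff.rfl
    rcases hirr S (fun s hs => by
      rw [hS] at hs ⊢
      have : Additive.ofMul (f s) = F (Additive.ofMul s) := rfl
      rw [this, hD, hs, map_zero]) with h | h
    · have : a.toMul ∈ S := (hS _).2 ha
      rw [h, Subgroup.mem_bot] at this
      exact this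
    · refine absurd (Subtype.ext (AddMonoidHom.ext fun x => ?_)) hd
      have : x.toMul ∈ S := by rw [h]; trivial
      exact (hS _).1 this
  have : Finite (AddMonoid.End (Additive A)) :=
    Finite.of_injective (fun g : AddMonoid.End (Additive A) => (g : Additive A → Additive A))
      DFunLike.coe_injective
  have : Nontrivial D := by
    obtain ⟨a, ha⟩ := exists_ne (1 : A)
    refine ⟨0, 1, fun h => ha ?_⟩
    have h1 := DFunLike.congr_fun (congrArg Subtype.val h) (Additive.ofMul a)
    exact h1.symm
  have : NoZeroDivisors D := ⟨fun {d e} hde => or_iff_not_imp_left.2 fun hd => by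
    refine Subtype.ext (AddMonoidHom.ext fun x => hinj d hd _ ?_)
    exact DFunLike.congr_fun (congrArg Subtype.val hde) x⟩
  have : IsDomain D := NoZeroDivisors.to_isDomain D
  let _ : Field D := (Finite.isDomain_to_isField D).toField
  let θ : ψ.range →* D :=
    { toFun := fun g => ⟨MonoidHom.toAdditive g.1.toMonoidHom, by
        refine Subring.mem_centralizer_iff.2 ?_
        rintro _ rfl
        obtain ⟨_, n, rfl⟩ := g
        exact AddMonoidHom.ext fun x => (hψ n x.toMul).symm⟩
      map_one' := rfl
      map_mul' := fun _ _ => rfl }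
  have hθ : Function.Injective θ := fun g h hgh => Subtype.ext (MulEquiv.ext fun x =>
    DFunLike.congr_fun (congrArg Subtype.val hgh) (Additive.ofMul x))
  have : Finite ψ.range := Finite.of_injective θ hθ
  exact isCyclic_of_injective_ringHom θ hθ

/-! ### Congruences, blocks and the displacement group -/

section Congruence

variable {Q : Type*} [Quandle Q]

theorem Dis.le_autGroup : Dis Q ≤ autGroup Q := by
  rw [Dis, Subgroup.closure_le]
  rintro _ ⟨a, b, rfl⟩
  exact mul_mem (act_mem_autGroup a) (inv_mem (act_mem_autGroup b))

theorem Dis.conj_mem {f : Equiv.Perm Q} (hf : f ∈ autGroup Q) {g : Equiv.Perm Q}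
    (hg : g ∈ Dis Q) : f * g * f⁻¹ ∈ Dis Q := by
  have hle : Dis Q ≤ (Dis Q).comap (MulAut.conj f).toMonoidHom := by
    conv_lhs => rw [Dis]
    rw [Subgroup.closure_le]
    rintro _ ⟨a, b, rfl⟩
    refine Subgroup.subset_closure ⟨f a, f b, ?_⟩
    rw [← autGroup.conj_act hf, ← autGroup.conj_act hf]
    simp only [MulEquiv.coe_toMonoidHom, MulAut.conj_apply]; group
  exact hle hg

/-- Conjugation by `L_a` as an automorphism of the displacement group. -/
def Dis.conj (a : Q) : MulAut (Dis Q) where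
  toFun g := ⟨Rack.act' a * g * (Rack.act' a)⁻¹, Dis.conj_mem (act_mem_autGroup a) g.2⟩
  invFun g := ⟨(Rack.act' a)⁻¹ * g * Rack.act' a, by
    simpa using Dis.conj_mem (inv_mem (act_mem_autGroup a)) g.2⟩
  left_inv g := Subtype.ext (by simp [mul_assoc])
  right_inv g := Subtype.ext (by simp [mul_assoc])
  map_mul' g h := Subtype.ext (by simp [mul_assoc])

theorem Dis.coe_conj (a : Q) (g : Dis Q) :
    (Dis.conj a g : Equiv.Perm Q) = Rack.act' a * g * (Rack.act' a)⁻¹ := rfl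

/-- At a given point `x`, the generator `L_a` takes the same value as the displacement `L_a L_x⁻¹`,
because `L_x` fixes `x`. Thus the two groups have the same orbits. -/
theorem Dis.exists_apply_eq (h : IsConnectedQuandle Q) (x y : Q) : ∃ g ∈ Dis Q, g x = y := by
  have hL : ∀ g ∈ LMlt Q, ∀ x, ∃ k ∈ Dis Q, k x = g x := by
    intro g hg
    induction hg using Subgroup.closure_induction with
    | mem g hg =>
      obtain ⟨a, rfl⟩ := hg
      exact fun x => ⟨Rack.act' a * (Rack.act' x)⁻¹, Subgroup.subset_closure ⟨a, x, rfl⟩, by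
        rw [Equiv.Perm.mul_apply, act_inv_self]⟩
    | one => exact fun x => ⟨1, one_mem _, rfl⟩
    | mul g h _ _ hg hh =>
      intro x
      obtain ⟨k, hk, hkx⟩ := hh x
      obtain ⟨l, hl, hlx⟩ := hg (h x)
      exact ⟨l * k, mul_mem hl hk, by rw [Equiv.Perm.mul_apply, hkx, hlx]; rfl⟩
    | inv g _ hg =>
      intro x
      obtain ⟨k, hk, hkx⟩ := hg (g⁻¹ x)
      exact ⟨k⁻¹, inv_mem hk, by rw [Equiv.Perm.inv_eq_iff_eq, hkx]; simp⟩
  obtain ⟨⟨g, hg⟩, hgx⟩ := h.exists_smul_eq x y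
  obtain ⟨k, hk, hkx⟩ := hL g hg x
  exact ⟨k, hk, hkx.trans hgx⟩

/-- The permutations preserving a congruence. -/
def QCon.presGroup (α : QCon Q) : Subgroup (Equiv.Perm Q) where
  carrier := {g | ∀ x y, α.toSetoid x y ↔ α.toSetoid (g x) (g y)}
  one_mem' := fun _ _ => Iff.rfl
  mul_mem' := fun hg hh x y => (hh x y).trans (hg _ _)
  inv_mem' := fun {g} hg x y => by
    rw [hg (g⁻¹ x) (g⁻¹ y)]; simp

theorem QCon.act_mem_presGroup (α : QCon Q) (a : Q) : Rack.act' a ∈ α.presGroup := by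
  intro x y
  refine ⟨fun h => α.act_congr (α.refl a) h, fun h => ?_⟩
  have := α.invAct_congr (α.refl a) h
  simpa using this

theorem QCon.dis_le_presGroup (α : QCon Q) : Dis Q ≤ α.presGroup := by
  rw [Dis, Subgroup.closure_le]
  rintro _ ⟨a, b, rfl⟩
  exact mul_mem (α.act_mem_presGroup a) (inv_mem (α.act_mem_presGroup b))

/-- The class of an element in the factor algebra. -/
def QCon.cls (α : QCon Q) (x : Q) : α.Factor := Quotient.mk α.toSetoid x

theorem QCon.cls_eq_cls {α : QCon Q} {x y : Q} : α.cls x = α.cls y ↔ α.toSetoid x y :=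
  Quotient.eq

theorem QCon.cls_surjective (α : QCon Q) : Function.Surjective α.cls := Quotient.mk_surjective

/-- The action of the displacement group on a factor. -/
def QCon.factorHom (α : QCon Q) : Dis Q →* Equiv.Perm α.Factor where
  toFun g := Quotient.congr g.1 fun x y => α.dis_le_presGroup g.2 x y
  map_one' := Equiv.ext fun x => Quotient.inductionOn x fun _ => rfl
  map_mul' _ _ := Equiv.ext fun x => Quotient.inductionOn x fun _ => rfl

theorem QCon.factorHom_mk (α : QCon Q) (g : Dis Q) (x : Q) :
    α.factorHom g (α.cls x) = α.cls (g.1 x) := rfl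

theorem QCon.act'_mk (α : QCon Q) (a x : Q) :
    Rack.act' (α.cls a) (α.cls x) = α.cls (Rack.act' a x) := rfl

theorem QCon.mem_ker {α : QCon Q} {g : Dis Q} :
    g ∈ α.factorHom.ker ↔ ∀ x, α.toSetoid (g.1 x) x := by
  rw [MonoidHom.mem_ker, Equiv.ext_iff]
  constructor
  · exact fun h x => QCon.cls_eq_cls.1 (h (α.cls x))
  · intro h x
    obtain ⟨x, rfl⟩ := α.cls_surjective x
    exact QCon.cls_eq_cls.2 (h x)

theorem QCon.factorHom_conj (α : QCon Q) (a : Q) (g : Dis Q) :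
    α.factorHom (Dis.conj a g) =
      Rack.act' (α.cls a) * α.factorHom g * (Rack.act' (α.cls a))⁻¹ := by
  rw [eq_mul_inv_iff_mul_eq]
  ext x
  obtain ⟨x, rfl⟩ := α.cls_surjective x
  simp only [Equiv.Perm.mul_apply, QCon.act'_mk, QCon.factorHom_mk, Dis.coe_conj]
  exact congrArg (fun y => α.cls (Rack.act' a (g.1 y))) ((Rack.act' a).symm_apply_apply x)

theorem QCon.factorHom_mem_autGroup (α : QCon Q) (g : Dis Q) :
    α.factorHom g ∈ autGroup α.Factor := by
  intro x y
  obtain ⟨x, rfl⟩ := α.cls_surjective x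
  obtain ⟨y, rfl⟩ := α.cls_surjective y
  exact congrArg α.cls (Dis.le_autGroup g.2 x y)

theorem QCon.conj_mem_ker {α : QCon Q} {a : Q} {g : Dis Q} :
    Dis.conj a g ∈ α.factorHom.ker ↔ g ∈ α.factorHom.ker := by
  rw [MonoidHom.mem_ker, QCon.factorHom_conj, MonoidHom.mem_ker, mul_inv_eq_one,
    mul_eq_left]

/-- The blocks of a congruence, as subquandles. -/
def QCon.block (α : QCon Q) (x : Q) : Subquandle Q where
  carrier := {y | α.toSetoid x y}
  act_mem := fun {a b} ha hb => by
    have := α.act_congr ha hb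
    rwa [Quandle.fix] at this
  invAct_mem := fun {a b} ha hb => by
    have := α.invAct_congr ha hb
    rwa [show x ◃⁻¹ x = x from act_inv_self x] at this

/-- The base point of a block. -/
def QCon.base (α : QCon Q) (x : Q) : (α.block x).carrier := ⟨x, α.refl x⟩

/-- The action on a block of the displacements which fix all blocks. -/
def QCon.blockHom (α : QCon Q) (x : Q) :
    α.factorHom.ker →* Equiv.Perm (α.block x).carrier where
  toFun g := Equiv.Perm.subtypePerm g.1.1 fun y => by
    have h := QCon.mem_ker.1 g.2 y
    exact ⟨fun hy => α.trans hy h, fun hy => α.trans hy (α.symm h)⟩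
  map_one' := rfl
  map_mul' _ _ := rfl

theorem QCon.blockHom_mem_autGroup (α : QCon Q) (x : Q) (g : α.factorHom.ker) :
    α.blockHom x g ∈ autGroup (α.block x).carrier :=
  fun y z => Subtype.ext (Dis.le_autGroup g.1.2 y.1 z.1)

theorem QCon.blockHom_conj (α : QCon Q) (x : Q) (g : α.factorHom.ker) :
    α.blockHom x ⟨Dis.conj x g.1, QCon.conj_mem_ker.2 g.2⟩ =
      Rack.act' (α.base x) * α.blockHom x g * (Rack.act' (α.base x))⁻¹ := by
  rw [eq_mul_inv_iff_mul_eq]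
  ext y
  exact congrArg (fun y => Rack.act' x (g.1.1 y)) ((Rack.act' x).symm_apply_apply y.1)

/-- A locally strictly simple quandle has no proper subquandle containing a nontrivial block and
an element of another block. -/
theorem IsLocallyStrictlySimple.eq_univ_of_block_subset (hQ : IsLocallyStrictlySimple Q)
    (α : QCon Q) (T : Subquandle Q) {x y z : Q} (hxT : (α.block x).carrier ⊆ T.carrier)
    (hxz : α.toSetoid x z) (hne : x ≠ z) (hy : y ∈ T.carrier) (hxy : ¬ α.toSetoid x y) :
    T.carrier = Set.univ := by
  by_contra hT
  have hx : x ∈ T.carrier := hxT (α.refl x)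
  have hz : z ∈ T.carrier := hxT hxz
  have hss := hQ T ⟨hT, x, hx, z, hz, hne⟩
  let U : Subquandle T.carrier :=
    { carrier := {w | α.toSetoid x w.1}
      act_mem := fun {a b} ha hb => (α.block x).act_mem ha hb
      invAct_mem := fun {a b} ha hb => (α.block x).invAct_mem ha hb }
  have := hss.carrier_eq_univ U (x := ⟨x, hx⟩) (y := ⟨z, hz⟩) (α.refl x) hxz
    fun h => hne (congrArg Subtype.val h)
  have hyU : (⟨y, hy⟩ : T.carrier) ∈ U.carrier := by rw [this]; trivial
  exact hxy hyU

end Congruence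

/-! ### Reduction to a congruence with strictly simple factor and blocks -/

/-- The data used below: a congruence `α` with strictly simple factor of order `q ^ n` and strictly
simple blocks of order `p ^ m` on which point stabilisers are pairwise different. -/
structure QCon.IsSplitting {Q : Type*} [Quandle Q] (α : QCon Q) (p q m n : ℕ) : Prop where
  finite : Finite Q
  prime_block : p.Prime
  prime_factor : q.Prime
  transitive : ∀ x y : Q, ∃ g ∈ Dis Q, g x = y
  factor_simple : IsStrictlySimple α.Factor
  block_simple : ∀ x, IsStrictlySimple (α.block x).carrier
  card_factor : Nat.card α.Factor = q ^ n
  card_block : ∀ x, Nat.card (α.block x).carrier = p ^ m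
  ne_zero_block : m ≠ 0
  ne_zero_factor : n ≠ 0
  separated : ∀ x y, α.toSetoid x y → (∀ g ∈ Dis Q, g x = x ↔ g y = y) → x = y
  eq_one : ∀ g ∈ Dis Q, ∀ x y, ¬ α.toSetoid x y → (∀ z, α.toSetoid x z → g z = z) →
    (∀ z, α.toSetoid y z → g z = z) → g = 1

theorem IsAbelianQuandle.of_factor_bot {Q : Type*} [Quandle Q] {β : QCon Q}
    (hβ : β.toSetoid = ⊥) (h : IsAbelianQuandle β.Factor) : IsAbelianQuandle Q := by
  have hinj : ∀ {x y : Q}, β.cls x = β.cls y → x = y := by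
    intro x y hxy
    have := QCon.cls_eq_cls.1 hxy
    rw [hβ] at this
    exact this
  have hev : ∀ {X : Type} (t : QTerm X) (v : X → Q),
      t.eval (fun i => β.cls (v i)) = β.cls (t.eval v) := by
    intro X t v
    induction t with
    | var x => rfl
    | act s t hs ht => simp only [QTerm.eval, hs, ht]; rfl
    | invAct s t hs ht => simp only [QTerm.eval, hs, ht]; rfl
  have helim : ∀ {k l : ℕ} (a : Fin k → Q) (u : Fin l → Q),
      Sum.elim (fun i => β.cls (a i)) (fun i => β.cls (u i)) =
        fun i => β.cls (Sum.elim a u i) := by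
    intro k l a u
    funext i
    cases i <;> rfl
  intro k l t a b u v htuv
  apply hinj
  have := h k l t (fun i => β.cls (a i)) (fun i => β.cls (b i)) (fun i => β.cls (u i))
    (fun i => β.cls (v i))
  rw [helim, helim, helim, helim, hev, hev, hev, hev] at this
  exact this (congrArg β.cls htuv)

/-- A congruence with abelian factor is not the identity relation, since `Q` is not abelian; so it
is `α` or the full relation, and `α ≤ γ_Q`. The hypothesis on `σ_Q` therefore separates points
within blocks. The simplicity of the factor and the field `eq_one` both follow because a subquandle
containing a block and a point outside it must be all of `Q`. -/
theorem InLSS.exists_isSplitting {Q : Type*} [Quandle Q] {p q m n : ℕ} {σ : Setoid Q}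
    (hp : p.Prime) (hq : q.Prime) (hQ : InLSS (p ^ m) (q ^ n) Q σ)
    (hσγ : sigma Q ⊓ (gamma Q).toSetoid = ⊥) :
    ∃ α : QCon Q, α.IsSplitting p q m n := by
  obtain ⟨α, hα, hF, hB⟩ := hQ.exists_unique_congruence
  obtain ⟨hbot, htop⟩ := (hα α).2 rfl
  have hfin := hQ.finite
  have hγ : α.toSetoid ≤ (gamma Q).toSetoid := by
    rw [gamma]
    refine le_sInf ?_
    rintro _ ⟨β, hβ, rfl⟩
    by_cases h1 : β.toSetoid = ⊥
    · exact absurd (IsAbelianQuandle.of_factor_bot h1 hβ) hQ.not_abelian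
    · by_cases h2 : β.toSetoid = ⊤
      · rw [h2]; exact le_top
      · rw [(hα β).1 ⟨h1, h2⟩]
  have hcard : ∀ x, Nat.card (α.block x).carrier = p ^ m := fun x => hB x
  obtain ⟨x₀, z₀, h₀, hne₀⟩ : ∃ x z, α.toSetoid x z ∧ x ≠ z := by
    by_contra h
    push Not at h
    exact hbot (eq_bot_iff.2 fun x z hxz => h x z hxz)
  obtain ⟨x₁, y₁, h₁⟩ : ∃ x y, ¬ α.toSetoid x y := by
    by_contra h
    push Not at h
    exact htop (eq_top_iff.2 fun x z _ => h x z)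
  have hm : m ≠ 0 := by
    rintro rfl
    have h := hcard x₀
    rw [pow_zero, Nat.card_eq_one_iff_unique] at h
    have := h.1
    exact hne₀ (congrArg Subtype.val (Subsingleton.elim (α.base x₀) ⟨z₀, h₀⟩))
  have hn : n ≠ 0 := by
    rintro rfl
    rw [pow_zero, Nat.card_eq_one_iff_unique] at hF
    have := hF.1
    exact h₁ (QCon.cls_eq_cls.1 (Subsingleton.elim (α.cls x₁) (α.cls y₁)))
  have hz : ∀ x, ∃ z, α.toSetoid x z ∧ x ≠ z := by
    intro x
    have : Nontrivial (α.block x).carrier := by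
      rw [← Finite.one_lt_card_iff_nontrivial, hcard]
      exact Nat.one_lt_pow hm hp.one_lt
    obtain ⟨z, hz⟩ := exists_ne (α.base x)
    exact ⟨z, z.2, fun h => hz (Subtype.ext h.symm)⟩
  have hLSS := hQ.locallyStrictlySimple
  refine ⟨α, hfin, hp, hq, Dis.exists_apply_eq hQ.connected, ?_, ?_, hF, hcard, hm, hn, ?_, ?_⟩
  · rintro S ⟨hS, a, ha, b, hb, hab⟩
    obtain ⟨x, rfl⟩ := α.cls_surjective a
    obtain ⟨y, rfl⟩ := α.cls_surjective b
    let T : Subquandle Q :=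
      { carrier := {x | α.cls x ∈ S.carrier}
        act_mem := fun ha hb => S.act_mem ha hb
        invAct_mem := fun ha hb => S.invAct_mem ha hb }
    obtain ⟨z, hxz, hne⟩ := hz x
    have := hLSS.eq_univ_of_block_subset α T (x := x) (y := y) (fun w hw => by
      have : α.cls w = α.cls x := QCon.cls_eq_cls.2 (α.symm hw)
      change α.cls w ∈ S.carrier
      rwa [this]) hxz hne hb (fun h => hab (QCon.cls_eq_cls.2 h))
    refine hS (Set.eq_univ_of_forall fun w => ?_)
    obtain ⟨w, rfl⟩ := α.cls_surjective w
    have hw : w ∈ T.carrier := by rw [this]; trivial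
    exact hw
  · intro x
    refine hLSS _ ⟨fun h => h₁ ?_, ?_⟩
    · have h1 : x₁ ∈ (α.block x).carrier := by rw [h]; trivial
      have h2 : y₁ ∈ (α.block x).carrier := by rw [h]; trivial
      exact α.trans (α.symm h1) h2
    · obtain ⟨z, hxz, hne⟩ := hz x
      exact ⟨x, α.refl x, z, hxz, hne⟩
  · intro x y hxy h
    have : (sigma Q ⊓ (gamma Q).toSetoid) x y := by
      refine ⟨?_, hγ hxy⟩
      change MulAction.stabilizer (Dis Q) x = MulAction.stabilizer (Dis Q) y
      ext g
      exact h g.1 g.2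
    rw [hσγ] at this
    exact this
  · intro g hg x y hxy hx hy
    obtain ⟨z, hxz, hne⟩ := hz x
    have := hLSS.eq_univ_of_block_subset α (fixSubquandle g (Dis.le_autGroup hg))
      (fun w hw => hx w hw) hxz hne (hy y (α.refl y)) hxy
    ext w
    have hw : w ∈ (fixSubquandle g (Dis.le_autGroup hg)).carrier := by rw [this]; trivial
    exact hw

/-! ### The kernel of the action on the blocks -/

section Splitting

open scoped commutatorElement

variable {Q : Type*} [Quandle Q] {α : QCon Q} {p q m n : ℕ}

/-- The regular subgroup of the image on the factor contains all displacements of the factor, and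
these generate the image. So the image is itself regular and elementary abelian, and a displacement
fixing one block fixes them all. -/
theorem QCon.IsSplitting.factor_regular (C : α.IsSplitting p q m n) :
    (∀ (g : Dis Q) (x : Q), α.toSetoid (g.1 x) x → g ∈ α.factorHom.ker) ∧
      (∀ g h : Dis Q, ⁅g, h⁆ ∈ α.factorHom.ker) ∧ (∀ g : Dis Q, g ^ q ∈ α.factorHom.ker) ∧
      Nat.card α.factorHom.range = q ^ n ∧
      ∀ (a : Q) (S : Subgroup (Dis Q)), α.factorHom.ker ≤ S → (∀ s ∈ S, Dis.conj a s ∈ S) →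
        S = α.factorHom.ker ∨ S = ⊤ := by
  have := C.finite
  have : Finite α.Factor := Finite.of_surjective _ α.cls_surjective
  have hM : α.factorHom.range ≤ autGroup α.Factor := by
    rintro _ ⟨g, rfl⟩
    exact α.factorHom_mem_autGroup g
  have htrans : ∀ x y, ∃ g ∈ α.factorHom.range, g x = y := by
    intro x y
    obtain ⟨x, rfl⟩ := α.cls_surjective x
    obtain ⟨y, rfl⟩ := α.cls_surjective y
    obtain ⟨g, hg, rfl⟩ := C.transitive x y
    exact ⟨_, ⟨⟨g, hg⟩, rfl⟩, rfl⟩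
  have key : ∀ a : Q, Nat.card α.factorHom.range = q ^ n ∧
      (∀ g ∈ α.factorHom.range, g = 1 ∨ ∀ x, g x ≠ x) ∧
      (∀ g ∈ α.factorHom.range, ∀ h ∈ α.factorHom.range, g * h = h * g) ∧
      (∀ g ∈ α.factorHom.range, g ^ q = 1) ∧
      (∀ S ≤ α.factorHom.range,
        (∀ s ∈ S, Rack.act' (α.cls a) * s * (Rack.act' (α.cls a))⁻¹ ∈ S) →
          S = ⊥ ∨ S = α.factorHom.range) := by
    intro a
    obtain ⟨P, hPM, hcard, hchar, hPt, hcomm, hexp, hirr, hnorm, -⟩ :=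
      C.factor_simple.exists_regular C.prime_factor C.card_factor _ hM htrans (α.cls a) (by
        rintro _ ⟨g, rfl⟩
        exact ⟨Dis.conj a g, α.factorHom_conj a g⟩)
    have hle : α.factorHom.range ≤ P := by
      rintro _ ⟨⟨g, hg⟩, rfl⟩
      induction hg using Subgroup.closure_induction with
      | mem g hg =>
        obtain ⟨b, c, rfl⟩ := hg
        convert act_mul_act_inv_mem (hPM.trans hM) (hPt (α.cls a)) hnorm (α.cls b) (α.cls c)
          using 1
        ext x
        obtain ⟨x, rfl⟩ := α.cls_surjective x
        rfl
      | one =>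
        have : α.factorHom ⟨1, one_mem _⟩ = 1 := map_one α.factorHom
        exact this ▸ one_mem P
      | mul g h hg hh h1 h2 =>
        have := map_mul α.factorHom ⟨g, hg⟩ ⟨h, hh⟩
        exact this ▸ mul_mem h1 h2
      | inv g hg h1 =>
        have := map_inv α.factorHom ⟨g, hg⟩
        exact this ▸ inv_mem h1
    have heq : α.factorHom.range = P := le_antisymm hle hPM
    rw [heq]
    exact ⟨hcard, fun g hg => (hchar g (hPM hg)).1 hg, hcomm, hexp, hirr⟩
  obtain ⟨a₀⟩ : Nonempty Q := by
    have h : 0 < Nat.card α.Factor := by rw [C.card_factor]; exact pow_pos C.prime_factor.pos n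
    obtain ⟨⟨x⟩, -⟩ := Nat.card_pos_iff.1 h
    exact ⟨(α.cls_surjective x).choose⟩
  obtain ⟨hcard, hreg, hcomm, hexp, -⟩ := key a₀
  refine ⟨fun g x hx => ?_, fun g h => ?_, fun g => ?_, hcard, fun a S hS hSa => ?_⟩
  · exact (hreg _ ⟨g, rfl⟩).resolve_right fun h => h (α.cls x) (QCon.cls_eq_cls.2 hx)
  · rw [MonoidHom.mem_ker, map_commutatorElement, commutatorElement_eq_one_iff_mul_comm]
    exact hcomm _ ⟨g, rfl⟩ _ ⟨h, rfl⟩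
  · rw [MonoidHom.mem_ker, map_pow]
    exact hexp _ ⟨g, rfl⟩
  · have hcomap : (S.map α.factorHom).comap α.factorHom = S := by
      rw [Subgroup.comap_map_eq, sup_eq_left.2 hS]
    rcases (key a).2.2.2.2 (S.map α.factorHom) (Subgroup.map_le_range _ _) (by
      rintro _ ⟨s, hs, rfl⟩
      exact ⟨Dis.conj a s, hSa s hs, α.factorHom_conj a s⟩) with h | h
    · left
      rw [← hcomap, h]; rfl
    · right
      rw [← hcomap, h, MonoidHom.range_eq_map, Subgroup.comap_map_eq, top_sup_eq]

/-- On the block of `x`, the permutation `g` is trivial or has no fixed points. -/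
def QCon.IsSemiregularAt (α : QCon Q) (x : Q) (g : Equiv.Perm Q) : Prop :=
  (∀ y, α.toSetoid x y → g y = y) ∨ ∀ y, α.toSetoid x y → g y ≠ y

/-- The block-fixing displacements are transitive on each block: a displacement joining two points
of a block fixes that block, hence every block. Here the image may be larger than its regular
subgroup. -/
theorem QCon.IsSplitting.block_regular (C : α.IsSplitting p q m n) (x : Q) :
    ∃ P : Subgroup (Equiv.Perm (α.block x).carrier), P ≤ (α.blockHom x).range ∧
      Nat.card P = p ^ m ∧
      (∀ g, α.blockHom x g ∈ P ↔ α.IsSemiregularAt x g.1.1) ∧ (∀ y z, ∃ g ∈ P, g y = z) ∧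
      (∀ g ∈ P, ∀ h ∈ P, g * h = h * g) ∧ (∀ g ∈ P, g ^ p = 1) ∧
      (∀ S ≤ P, (∀ s ∈ S, Rack.act' (α.base x) * s * (Rack.act' (α.base x))⁻¹ ∈ S) →
        S = ⊥ ∨ S = P) ∧
      (∀ g ∈ P, Rack.act' (α.base x) * g * (Rack.act' (α.base x))⁻¹ ∈ P) ∧
      (∀ g ∈ (α.blockHom x).range, ∀ j : ℕ, g ^ p ^ j = 1 → g ∈ P) := by
  have := C.finite
  obtain ⟨P, hPM, hcard, hchar, hPt, hcomm, hexp, hirr, hnorm, hp⟩ :=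
    (C.block_simple x).exists_regular C.prime_block (C.card_block x) (α.blockHom x).range (by
      rintro _ ⟨g, rfl⟩
      exact α.blockHom_mem_autGroup x g) (by
      intro y z
      obtain ⟨g, hg, hgy⟩ := C.transitive y.1 z.1
      have hk : (⟨g, hg⟩ : Dis Q) ∈ α.factorHom.ker := C.factor_regular.1 _ y.1 (by
        rw [hgy]; exact α.trans (α.symm z.2) y.2)
      exact ⟨_, ⟨⟨_, hk⟩, rfl⟩, Subtype.ext hgy⟩) (α.base x) (by
      rintro _ ⟨g, rfl⟩
      exact ⟨_, α.blockHom_conj x g⟩)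
  refine ⟨P, hPM, hcard, fun g => ?_, hPt, hcomm, hexp, hirr, hnorm, hp⟩
  rw [hchar _ ⟨g, rfl⟩]
  refine or_congr ⟨fun h y hy => ?_, fun h => ?_⟩ ⟨fun h y hy hgy => ?_, fun h y hgy => ?_⟩
  · exact congrArg Subtype.val (Equiv.ext_iff.1 h ⟨y, hy⟩)
  · exact Equiv.ext fun y => Subtype.ext (h y.1 y.2)
  · exact h ⟨y, hy⟩ (Subtype.ext hgy)
  · exact h y.1 y.2 (congrArg Subtype.val hgy)

/-- The displacements which fix all blocks and act semiregularly on each of them. -/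
def QCon.IsSplitting.kernel (C : α.IsSplitting p q m n) : Subgroup (Dis Q) where
  carrier := {g | g ∈ α.factorHom.ker ∧ ∀ x, α.IsSemiregularAt x g.1}
  one_mem' := ⟨one_mem _, fun _ => Or.inl fun _ _ => rfl⟩
  mul_mem' := fun {g h} hg hh => ⟨mul_mem hg.1 hh.1, fun x => by
    obtain ⟨P, -, -, hP, -⟩ := C.block_regular x
    have h1 := mul_mem ((hP ⟨g, hg.1⟩).2 (hg.2 x)) ((hP ⟨h, hh.1⟩).2 (hh.2 x))
    rw [← map_mul, hP] at h1
    exact h1⟩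
  inv_mem' := fun {g} hg => ⟨inv_mem hg.1, fun x => by
    obtain ⟨P, -, -, hP, -⟩ := C.block_regular x
    have h1 := inv_mem ((hP ⟨g, hg.1⟩).2 (hg.2 x))
    rw [← map_inv, hP] at h1
    exact h1⟩

theorem QCon.IsSplitting.kernel_comm (C : α.IsSplitting p q m n) {g h : Dis Q}
    (hg : g ∈ C.kernel) (hh : h ∈ C.kernel) : g * h = h * g := by
  refine Subtype.ext (Equiv.ext fun x => ?_)
  obtain ⟨P, -, -, hP, -, hcomm, -⟩ := C.block_regular x
  have h1 := hcomm _ ((hP ⟨g, hg.1⟩).2 (hg.2 x)) _ ((hP ⟨h, hh.1⟩).2 (hh.2 x))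
  exact congrArg Subtype.val (Equiv.ext_iff.1 h1 (α.base x))

theorem QCon.IsSplitting.kernel_pow (C : α.IsSplitting p q m n) {g : Dis Q}
    (hg : g ∈ C.kernel) : g ^ p = 1 := by
  refine Subtype.ext (Equiv.ext fun x => ?_)
  obtain ⟨P, -, -, hP, -, -, hexp, -⟩ := C.block_regular x
  have h1 := hexp _ ((hP ⟨g, hg.1⟩).2 (hg.2 x))
  rw [← map_pow] at h1
  exact congrArg Subtype.val (Equiv.ext_iff.1 h1 (α.base x))

/-- The exponent `t` is a multiple of the `p'`-part of the group order and congruent to `1` modulo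
`p`, so it extracts a `p`-part without changing elements of exponent `p`. -/
theorem exists_pow_eq_of_pow_eq_one {G : Type*} [Group G] [Finite G] {p : ℕ} (hp : p.Prime) :
    ∃ t j : ℕ, (∀ g : G, (g ^ t) ^ p ^ j = 1) ∧
      ∀ (H : Type _) [Group H] (h : H), h ^ p = 1 → h ^ t = h := by
  obtain ⟨j, s, hs, hcard⟩ := Nat.exists_eq_pow_mul_and_not_dvd
    (Nat.card_pos (α := G)).ne' p hp.ne_one
  have hcop : Nat.Coprime s p := ((Nat.Prime.coprime_iff_not_dvd hp).2 hs).symm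
  obtain ⟨u, hu⟩ := Nat.exists_mul_mod_eq_one_of_coprime hcop hp.one_lt
  refine ⟨s * u, j, fun g => ?_, fun H _ h hh => ?_⟩
  · rw [← pow_mul, show s * u * p ^ j = Nat.card G * u by rw [hcard]; ring, pow_mul,
      pow_card_eq_one', one_pow]
  · rw [← Nat.div_add_mod (s * u) p, hu.2, pow_add, pow_mul, hh, one_pow, one_mul, pow_one]

/-- A lift of an element regular on the block of `x` may misbehave on other blocks. Its `t`-th power
acts identically on this block and has `p`-power order, so it lands in the Frobenius kernel of every
block. -/
theorem QCon.IsSplitting.kernel_transitive (C : α.IsSplitting p q m n) {x y : Q}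
    (hxy : α.toSetoid x y) : ∃ g ∈ C.kernel, g.1 x = y := by
  have := C.finite
  obtain ⟨t, j, htj, ht⟩ := exists_pow_eq_of_pow_eq_one (G := α.factorHom.ker) C.prime_block
  obtain ⟨P, hPM, -, hP, hPt, -, hexp, -⟩ := C.block_regular x
  obtain ⟨h, hh, hhx⟩ := hPt (α.base x) ⟨y, hxy⟩
  obtain ⟨g, rfl⟩ := hPM hh
  refine ⟨(g ^ t).1, ⟨(g ^ t).2, fun z => ?_⟩, ?_⟩
  · obtain ⟨P', -, -, hP', -, -, -, -, -, hp⟩ := C.block_regular z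
    rw [← hP']
    exact hp _ ⟨_, rfl⟩ j (by rw [← map_pow, htj, map_one])
  · have h1 : α.blockHom x (g ^ t) = α.blockHom x g := by
      rw [map_pow, ht _ _ (hexp _ hh)]
    have h2 := congrArg Subtype.val hhx
    rw [← h1] at h2
    exact h2

theorem QCon.IsSplitting.exists_mul_of_mem_ker (C : α.IsSplitting p q m n) {g : Dis Q}
    (hg : g ∈ α.factorHom.ker) (x : Q) :
    ∃ h ∈ C.kernel, ∃ s ∈ α.factorHom.ker, s.1 x = x ∧ g = h * s := by
  obtain ⟨h, hh, hhx⟩ := C.kernel_transitive (α.symm (QCon.mem_ker.1 hg x))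
  refine ⟨h, hh, h⁻¹ * g, mul_mem (inv_mem hh.1) hg, ?_, by group⟩
  change (h.1⁻¹ * g.1) x = x
  rw [Equiv.Perm.mul_apply, Equiv.Perm.inv_eq_iff_eq, hhx]

theorem QCon.IsSemiregularAt.conj {x : Q} {g k : Equiv.Perm Q}
    (hk : k ∈ α.presGroup) (hg : α.IsSemiregularAt x g) :
    α.IsSemiregularAt (k x) (k * g * k⁻¹) := by
  have hk' : ∀ y, α.toSetoid (k x) y → α.toSetoid x (k⁻¹ y) := fun y hy => by
    rw [hk x (k⁻¹ y)]; simpa using hy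
  refine hg.imp (fun h y hy => ?_) fun h y hy hgy => h _ (hk' y hy) ?_
  · simp only [Equiv.Perm.mul_apply, h _ (hk' y hy)]
    exact k.apply_symm_apply y
  · exact Equiv.Perm.eq_inv_iff_eq.2 hgy

theorem QCon.IsSplitting.kernel_normal (C : α.IsSplitting p q m n) : C.kernel.Normal :=
  ⟨fun g hg k => ⟨Subgroup.Normal.conj_mem inferInstance g hg.1 k, fun x => by
    have h1 := (hg.2 (k.1⁻¹ x)).conj (α.dis_le_presGroup k.2)
    rw [show k.1 (k.1⁻¹ x) = x from k.1.apply_symm_apply x] at h1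
    exact h1⟩⟩

theorem QCon.IsSplitting.conj_mem_kernel (C : α.IsSplitting p q m n) (a : Q) {g : Dis Q}
    (hg : g ∈ C.kernel) : Dis.conj a g ∈ C.kernel :=
  ⟨QCon.conj_mem_ker.2 hg.1, fun x => by
    have h1 := (hg.2 ((Rack.act' a)⁻¹ x)).conj (α.act_mem_presGroup a)
    rw [show Rack.act' a ((Rack.act' a)⁻¹ x) = x from (Rack.act' a).apply_symm_apply x] at h1
    exact h1⟩

/-- Modulo the kernel, `g` may be replaced by a displacement fixing `a`, and such an automorphism
commutes with `L_a`. -/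
theorem QCon.IsSplitting.conj_mul_inv_mem_kernel (C : α.IsSplitting p q m n) (a : Q) {g : Dis Q}
    (hg : g ∈ α.factorHom.ker) : Dis.conj a g * g⁻¹ ∈ C.kernel := by
  obtain ⟨h, hh, s, -, hsa, rfl⟩ := C.exists_mul_of_mem_ker hg a
  have hs : Dis.conj a s = s := by
    refine Subtype.ext ?_
    rw [Dis.coe_conj, mul_inv_eq_iff_eq_mul]
    have := autGroup.conj_act (Dis.le_autGroup s.2) a
    rw [hsa] at this
    rw [← mul_inv_eq_iff_eq_mul.1 this]
  rw [map_mul, hs, mul_inv_rev, mul_assoc, mul_inv_cancel_left]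
  exact mul_mem (C.conj_mem_kernel a hh) (inv_mem hh)

/-- All conjugations by `L_a` and `L_b` act trivially on the block-fixing displacements modulo the
kernel; hence so do the generators `L_a L_b⁻¹`. -/
theorem QCon.IsSplitting.commutator_mem_kernel (C : α.IsSplitting p q m n) (k : Dis Q)
    {g : Dis Q} (hg : g ∈ α.factorHom.ker) : k * g * k⁻¹ * g⁻¹ ∈ C.kernel := by
  have := C.kernel_normal
  let π := QuotientGroup.mk' C.kernel
  have hπ : ∀ x y : Dis Q, x * y⁻¹ ∈ C.kernel ↔ π x = π y := by
    intro x y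
    rw [← QuotientGroup.eq_one_iff, ← mul_inv_eq_one (a := π x)]
    rfl
  have hconj : ∀ a : Q, ∀ g ∈ α.factorHom.ker, π (Dis.conj a g) = π g := fun a g hg =>
    (hπ _ _).1 (C.conj_mul_inv_mem_kernel a hg)
  rw [hπ]
  suffices h : π k * π g = π g * π k by
    rw [map_mul, map_mul, h, map_inv, mul_inv_cancel_right]
  obtain ⟨k, hk⟩ := k
  induction hk using Subgroup.closure_induction with
  | mem k hk =>
    obtain ⟨a, b, rfl⟩ := hk
    let g' := (Dis.conj b).symm g
    have hb : Dis.conj b g' = g := (Dis.conj b).apply_symm_apply g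
    have hg' : g' ∈ α.factorHom.ker := by rw [← QCon.conj_mem_ker (a := b), hb]; exact hg
    have h1 : π (Dis.conj a g') = π (Dis.conj b g') := by rw [hconj a _ hg', hconj b _ hg']
    rw [hb] at h1
    have h2 : (⟨_, Subgroup.subset_closure ⟨a, b, rfl⟩⟩ : Dis Q) * g =
        Dis.conj a g' * ⟨Rack.act' a * (Rack.act' b)⁻¹,
          Subgroup.subset_closure ⟨a, b, rfl⟩⟩ := by
      rw [← hb]
      refine Subtype.ext ?_
      simp only [Subgroup.coe_mul, Dis.coe_conj]
      group
    rw [← map_mul, h2, map_mul, h1]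
  | one =>
    have : π (⟨1, one_mem _⟩ : Dis Q) = 1 := map_one π
    rw [this, one_mul, mul_one]
  | mul x y hx hy h1 h2 =>
    have : π (⟨x * y, mul_mem hx hy⟩ : Dis Q) = π ⟨x, hx⟩ * π ⟨y, hy⟩ := map_mul π ⟨x, hx⟩ ⟨y, hy⟩
    rw [this, mul_assoc, h2, ← mul_assoc, h1, mul_assoc]
  | inv x hx h1 =>
    have : π (⟨x⁻¹, inv_mem hx⟩ : Dis Q) = (π ⟨x, hx⟩)⁻¹ := map_inv π ⟨x, hx⟩
    rw [this]
    exact (Commute.inv_left (show Commute _ _ from h1)).eq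

/-- Carrying another block to that of `x` replaces `g` by a conjugate, which differs from `g` only
by an element of the kernel. So semiregularity on one block spreads to all. -/
theorem QCon.IsSplitting.mem_kernel_of_isSemiregularAt (C : α.IsSplitting p q m n) {g : Dis Q}
    (hg : g ∈ α.factorHom.ker) {x : Q} (hx : α.IsSemiregularAt x g.1) : g ∈ C.kernel := by
  refine ⟨hg, fun y => ?_⟩
  obtain ⟨k, hk, rfl⟩ := C.transitive x y
  obtain ⟨P, -, -, hP, -⟩ := C.block_regular x
  have h1 := C.commutator_mem_kernel ⟨k, hk⟩⁻¹ hg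
  have hg' : (⟨k, hk⟩⁻¹ : Dis Q) * g * (⟨k, hk⟩⁻¹)⁻¹ ∈ α.factorHom.ker :=
    Subgroup.Normal.conj_mem inferInstance g hg _
  have h2 := mul_mem ((hP ⟨_, h1.1⟩).2 (h1.2 x)) ((hP ⟨g, hg⟩).2 hx)
  rw [← map_mul, hP] at h2
  have h3 := h2.conj (α.dis_le_presGroup hk)
  convert h3 using 1
  simp only [Subgroup.coe_mul, InvMemClass.coe_inv]
  group

theorem QCon.IsSplitting.apply_eq_of_mem_kernel (C : α.IsSplitting p q m n) {g : Dis Q}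
    (hg : g ∈ C.kernel) {x y : Q} (hx : g.1 x = x) (hxy : α.toSetoid x y) : g.1 y = y :=
  (hg.2 x).resolve_right (fun h => h x (α.refl x) hx) y hxy

/-- The block-fixing displacements act by conjugation on the regular abelian group `P` of the block.
This action commutes with that of `L_x`, because `L g L⁻¹ g⁻¹` lies in `P`; so its image is cyclic.
An element centralising `P` acts on the block as a member of `P`, hence lies in the kernel. -/
theorem QCon.IsSplitting.exists_generator (C : α.IsSplitting p q m n) (x : Q) :
    ∃ c ∈ α.factorHom.ker, ∀ g ∈ α.factorHom.ker, ∃ k : ℤ, (c ^ k)⁻¹ * g ∈ C.kernel := by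
  have := C.finite
  obtain ⟨P, hPM, hcard, hP, hPt, hcomm, -, hirr, hnorm, -⟩ := C.block_regular x
  let M := (α.blockHom x).range
  let A := P.subgroupOf M
  have hmem : ∀ g : M, g ∈ A ↔ g.1 ∈ P := fun g => Iff.rfl
  have hA : A.Normal := ⟨by
    rintro ⟨_, g, rfl⟩ hg ⟨_, k, rfl⟩
    rw [hmem] at hg ⊢
    change α.blockHom x k * α.blockHom x g * (α.blockHom x k)⁻¹ ∈ P
    have hg' : α.blockHom x g ∈ P := hg
    rw [← map_mul, ← map_inv, ← map_mul, hP]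
    rw [hP] at hg'
    have h1 := hg'.conj (α.dis_le_presGroup k.1.2)
    have hk : α.toSetoid x (k.1.1 x) := α.symm (QCon.mem_ker.1 k.2 x)
    exact h1.imp (fun h y hy => h y (α.trans (α.symm hk) hy))
      fun h y hy => h y (α.trans (α.symm hk) hy)⟩
  let _ : CommGroup A :=
    { (inferInstance : Group A) with
      mul_comm := fun a b => Subtype.ext (Subtype.ext (hcomm _ a.2 _ b.2)) }
  have hAcard : Nat.card A = p ^ m := by
    rw [← hcard]
    exact Nat.card_congr (Subgroup.subgroupOfEquivOfLe hPM).toEquiv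
  have : Nontrivial A := by
    rw [← Finite.one_lt_card_iff_nontrivial, hAcard]
    exact Nat.one_lt_pow C.ne_zero_block C.prime_block.one_lt
  let L := Rack.act' (α.base x)
  let f : A →* A :=
    { toFun := fun a => ⟨⟨L * a.1.1 * L⁻¹, hPM (hnorm _ a.2)⟩, hnorm _ a.2⟩
      map_one' := Subtype.ext (Subtype.ext (by simp))
      map_mul' := fun a b => Subtype.ext (Subtype.ext (by simp [mul_assoc])) }
  let ψ : α.factorHom.ker →* MulAut A :=
    (MulAut.conjNormal (H := A)).comp (α.blockHom x).rangeRestrict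
  have hψ : ∀ g a, ((ψ g a).1.1 : Equiv.Perm _) =
      α.blockHom x g * a.1.1 * (α.blockHom x g)⁻¹ := fun g a => rfl
  have hf : ∀ a, ((f a).1.1 : Equiv.Perm _) = L * a.1.1 * L⁻¹ := fun a => rfl
  have hcyc : IsCyclic ψ.range := by
    refine isCyclic_range_of_irreducible f ψ (fun g a => Subtype.ext (Subtype.ext ?_))
      fun S hS => ?_
    · have h1 := (hP ⟨_, (C.conj_mul_inv_mem_kernel x g.2).1⟩).2
        ((C.conj_mul_inv_mem_kernel x g.2).2 x)
      have h2 : α.blockHom x ⟨_, (C.conj_mul_inv_mem_kernel x g.2).1⟩ =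
          L * α.blockHom x g * L⁻¹ * (α.blockHom x g)⁻¹ := by
        rw [← α.blockHom_conj, ← map_inv, ← map_mul]
        rfl
      rw [h2] at h1
      have hfa : L * a.1.1 * L⁻¹ ∈ P := hnorm _ a.2
      have hga : α.blockHom x g * (L * a.1.1 * L⁻¹) * (α.blockHom x g)⁻¹ ∈ P := (ψ g (f a)).2
      have h3 := hcomm _ h1 _ hga
      rw [hψ, hf, hf, hψ]
      rw [← mul_left_inj (L * α.blockHom x g * L⁻¹ * (α.blockHom x g)⁻¹), ← h3]
      group
    · let S' : Subgroup (Equiv.Perm (α.block x).carrier) := (S.map A.subtype).map M.subtype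
      have hS' : ∀ s, s ∈ S' ↔ ∃ a ∈ S, a.1.1 = s := by
        intro s
        constructor
        · rintro ⟨_, ⟨a, ha, rfl⟩, rfl⟩
          exact ⟨a, ha, rfl⟩
        · rintro ⟨a, ha, rfl⟩
          exact ⟨_, ⟨a, ha, rfl⟩, rfl⟩
      rcases hirr S' (fun s hs => by
          obtain ⟨a, -, rfl⟩ := (hS' s).1 hs
          exact a.2) (fun s hs => by
          obtain ⟨a, ha, rfl⟩ := (hS' s).1 hs
          exact (hS' _).2 ⟨f a, hS a ha, rfl⟩) with h | h
      · left
        rw [eq_bot_iff]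
        intro a ha
        have : a.1.1 ∈ S' := (hS' _).2 ⟨a, ha, rfl⟩
        rw [h, Subgroup.mem_bot] at this
        exact Subtype.ext (Subtype.ext this)
      · right
        rw [eq_top_iff]
        intro a _
        have : a.1.1 ∈ S' := by rw [h]; exact a.2
        obtain ⟨b, hb, hba⟩ := (hS' _).1 this
        rwa [← Subtype.ext (Subtype.ext hba) (a1 := b)]
  obtain ⟨⟨_, c, rfl⟩, hc⟩ := hcyc.exists_generator
  refine ⟨c.1, c.2, fun g hg => ?_⟩
  obtain ⟨k, hk⟩ := hc ⟨_, ⟨g, hg⟩, rfl⟩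
  refine ⟨k, ?_⟩
  let u : α.factorHom.ker := (c ^ k)⁻¹ * ⟨g, hg⟩
  have hu : ψ u = 1 := by
    have h1 : ψ c ^ k = ψ ⟨g, hg⟩ := congrArg Subtype.val hk
    rw [map_mul, map_inv, map_zpow, h1, inv_mul_cancel]
  change u.1 ∈ C.kernel
  refine C.mem_kernel_of_isSemiregularAt u.2 (x := x) ?_
  obtain ⟨h, hh, s, hs, hsx, hus⟩ := C.exists_mul_of_mem_ker u.2 x
  have hhP := (hP ⟨h, hh.1⟩).2 (hh.2 x)
  have hus' : u = ⟨h, hh.1⟩ * ⟨s, hs⟩ := Subtype.ext hus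
  -- Both `u` and `h` centralise `P`, hence so does `s`; since `s` fixes the base point and `P` is
  -- transitive, `s` is trivial on the block.
  have hs1 : α.blockHom x ⟨s, hs⟩ = 1 := by
    ext y
    obtain ⟨t, ht, hty⟩ := hPt (α.base x) y
    let t' : A := ⟨⟨t, hPM ht⟩, ht⟩
    have e0 : ψ u t' = t' := by rw [hu]; rfl
    have e1 : α.blockHom x u * t * (α.blockHom x u)⁻¹ = t := congrArg (fun b : A => b.1.1) e0
    rw [hus', map_mul] at e1
    have e2 := hcomm _ hhP _ ht
    have e3 : α.blockHom x ⟨s, hs⟩ * t = t * α.blockHom x ⟨s, hs⟩ := by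
      have := mul_inv_eq_iff_eq_mul.1 e1
      rw [← mul_assoc, ← e2, mul_assoc, mul_assoc] at this
      exact mul_left_cancel this
    have e4 := Equiv.ext_iff.1 e3 (α.base x)
    have e5 : α.blockHom x ⟨s, hs⟩ (α.base x) = α.base x := Subtype.ext hsx
    rw [Equiv.Perm.mul_apply, Equiv.Perm.mul_apply, e5, hty] at e4
    exact congrArg Subtype.val e4
  rw [← hP, hus', map_mul, hs1, mul_one]
  exact hhP

end Splitting

/-! ### The extraspecial quotient, the divisibility and the rank of the kernel -/

section Splitting

open scoped commutatorElement

variable {Q : Type*} [Quandle Q] {α : QCon Q} {p q m n : ℕ}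

theorem QCon.IsSplitting.nonempty (C : α.IsSplitting p q m n) : Nonempty Q := by
  have := C.finite
  have h : 0 < Nat.card α.Factor := by rw [C.card_factor]; exact pow_pos C.prime_factor.pos n
  obtain ⟨⟨x⟩, -⟩ := Nat.card_pos_iff.1 h
  exact ⟨(α.cls_surjective x).choose⟩

/-- With equality, every displacement fixing a point would fix its whole block pointwise, so points
of a block would share their stabilisers, against `separated`. -/
theorem QCon.IsSplitting.kernel_ne_ker (C : α.IsSplitting p q m n) :
    C.kernel ≠ α.factorHom.ker := by
  have := C.finite
  intro h
  obtain ⟨x⟩ := C.nonempty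
  have : Nontrivial (α.block x).carrier := by
    rw [← Finite.one_lt_card_iff_nontrivial, C.card_block]
    exact Nat.one_lt_pow C.ne_zero_block C.prime_block.one_lt
  obtain ⟨y, hy⟩ := exists_ne (α.base x)
  have key : ∀ g ∈ Dis Q, ∀ z w, α.toSetoid z w → g z = z → g w = w := by
    intro g hg z w hzw hz
    have hk : (⟨g, hg⟩ : Dis Q) ∈ C.kernel := by
      rw [h]
      exact C.factor_regular.1 _ z (by rw [hz])
    exact C.apply_eq_of_mem_kernel hk hz hzw
  exact hy (Subtype.ext (C.separated x y.1 y.2 fun g hg =>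
    ⟨key g hg _ _ y.2, key g hg _ _ (α.symm y.2)⟩).symm)

/-- The factor of the displacement group by the kernel is extraspecial. -/
theorem QCon.IsSplitting.exists_extraspecial (C : α.IsSplitting p q m n) :
    ∃ (K : Type) (_ : Group K) (π : Dis Q →* K), Function.Surjective π ∧ π.ker = C.kernel ∧
      IsExtraspecial q K ∧ (Odd q → Monoid.exponent K = q) ∧ Even n ∧
      Nat.card K = q ^ (n + 1) := by
  have := C.finite
  have := C.kernel_normal
  obtain ⟨a⟩ := C.nonempty
  obtain ⟨-, hcomm, hpow, hcard, hirr⟩ := C.factor_regular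
  obtain ⟨K, _, _, ⟨e⟩⟩ := Finite.exists_type_univ_nonempty_mulEquiv (Dis Q ⧸ C.kernel)
  let π : Dis Q →* K := e.toMonoidHom.comp (QuotientGroup.mk' C.kernel)
  have hπs : Function.Surjective π := e.surjective.comp (QuotientGroup.mk'_surjective _)
  have hπ1 : ∀ g, π g = 1 ↔ g ∈ C.kernel := fun g => by
    rw [← QuotientGroup.eq_one_iff g]
    exact map_eq_one_iff e e.injective
  have hker : π.ker = C.kernel := by ext g; exact hπ1 g
  have hmap : C.kernel.map (Dis.conj a).toMonoidHom = C.kernel := by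
    refine Subgroup.eq_of_le_of_card_ge ?_ (le_of_eq
      (Nat.card_congr (C.kernel.equivMapOfInjective _ (Dis.conj a).injective).toEquiv))
    rintro _ ⟨g, hg, rfl⟩
    exact C.conj_mem_kernel a hg
  let φ : MulAut K :=
    (e.symm.trans (QuotientGroup.congr C.kernel C.kernel (Dis.conj a) hmap)).trans e
  have hφ : ∀ g, φ (π g) = π (Dis.conj a g) := fun g => by
    change e (QuotientGroup.congr C.kernel C.kernel (Dis.conj a) hmap (e.symm (e g))) = _
    rw [e.symm_apply_apply]
    rfl
  have hmem : ∀ g, π g ∈ α.factorHom.ker.map π ↔ g ∈ α.factorHom.ker := by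
    intro g
    refine ⟨?_, fun h => ⟨g, h, rfl⟩⟩
    rintro ⟨h, hh, hhg⟩
    have h1 : h⁻¹ * g ∈ C.kernel := by rw [← hπ1, map_mul, map_inv, hhg, inv_mul_cancel]
    have h2 := mul_mem hh h1.1
    rwa [mul_inv_cancel_left] at h2
  refine ⟨K, inferInstance, π, hπs, hker, extraspecial_of_irreducible C.prime_factor φ
    (α.factorHom.ker.map π) ?_ ?_ ?_ ?_ ?_ ?_ ?_ ?_ ?_⟩
  · rintro _ ⟨g, hg, rfl⟩
    rw [Subgroup.mem_center_iff]
    intro k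
    obtain ⟨k, rfl⟩ := hπs k
    have h1 := (hπ1 _).2 (C.commutator_mem_kernel k hg)
    rw [map_mul, map_mul, map_mul, map_inv, map_inv, mul_inv_eq_one, mul_inv_eq_iff_eq_mul] at h1
    exact h1
  · rintro _ ⟨g, hg, rfl⟩
    have h1 := (hπ1 _).2 (C.conj_mul_inv_mem_kernel a hg)
    rw [map_mul, map_inv, mul_inv_eq_one] at h1
    rw [hφ, h1]
  · rw [eq_top_iff]
    intro k _
    obtain ⟨⟨k, hk⟩, rfl⟩ := hπs k
    -- If the displacement `x` sends `a` to `b`, then `L_b = x L_a x⁻¹`, so `L_b L_a⁻¹` is `x` times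
    -- the inverse of its conjugate by `L_a`.
    have hgen : ∀ b : Q, ∀ h, π ⟨Rack.act' b * (Rack.act' a)⁻¹, h⟩ ∈
        Subgroup.closure {x | ∃ y, x = y * (φ y)⁻¹} := by
      intro b h
      obtain ⟨x, hx, rfl⟩ := C.transitive a b
      refine Subgroup.subset_closure ⟨π ⟨x, hx⟩, ?_⟩
      rw [hφ, ← map_inv, ← map_mul]
      congr 1
      refine Subtype.ext ?_
      simp only [Subgroup.coe_mul, InvMemClass.coe_inv, Dis.coe_conj,
        ← autGroup.conj_act (Dis.le_autGroup hx)]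
      group
    induction hk using Subgroup.closure_induction with
    | mem k hk =>
      obtain ⟨b, c, rfl⟩ := hk
      have hb := hgen b (Subgroup.subset_closure ⟨b, a, rfl⟩)
      have hc := hgen c (Subgroup.subset_closure ⟨c, a, rfl⟩)
      have := mul_mem hb (inv_mem hc)
      rw [← map_inv, ← map_mul] at this
      convert this using 2
      refine Subtype.ext ?_
      simp only [Subgroup.coe_mul, InvMemClass.coe_inv]
      group
    | one =>
      have : π ⟨1, one_mem _⟩ = 1 := map_one π
      exact this ▸ one_mem _
    | mul x y hx hy h1 h2 =>
      have : π ⟨x * y, mul_mem hx hy⟩ = π ⟨x, hx⟩ * π ⟨y, hy⟩ := map_mul π ⟨x, hx⟩ ⟨y, hy⟩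
      exact this ▸ mul_mem (h1 trivial) (h2 trivial)
    | inv x hx h1 =>
      have : π ⟨x⁻¹, inv_mem hx⟩ = (π ⟨x, hx⟩)⁻¹ := map_inv π ⟨x, hx⟩
      exact this ▸ inv_mem (h1 trivial)
  · intro k
    obtain ⟨k, rfl⟩ := hπs k
    rw [← map_pow, hmem]
    exact hpow k
  · intro k l
    obtain ⟨k, rfl⟩ := hπs k
    obtain ⟨l, rfl⟩ := hπs l
    rw [← map_commutatorElement, hmem]
    exact hcomm k l
  · intro S hS hSφ
    have hST : (S.comap π).map π = S := Subgroup.map_comap_eq_self_of_surjective hπs S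
    rcases hirr a (S.comap π) (fun g hg => hS ⟨g, hg, rfl⟩) (fun g hg => by
      rw [Subgroup.mem_comap, ← hφ]
      exact hSφ _ hg) with h | h
    · left; rw [← hST, h]
    · right; rw [← hST, h, ← MonoidHom.range_eq_map, MonoidHom.range_eq_top.2 hπs]
  · obtain ⟨c, hc, hgen⟩ := C.exists_generator a
    refine ⟨π c, ⟨c, hc, rfl⟩, ?_⟩
    rintro _ ⟨g, hg, rfl⟩
    obtain ⟨k, hk⟩ := hgen g hg
    refine ⟨k, ?_⟩
    rw [← hπ1, map_mul, map_inv, inv_mul_eq_one, map_zpow] at hk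
    exact hk.symm
  · intro h
    refine C.kernel_ne_ker (le_antisymm (fun g hg => hg.1) fun g hg => ?_)
    have : π g ∈ α.factorHom.ker.map π := ⟨g, hg, rfl⟩
    rw [h, Subgroup.mem_bot] at this
    exact (hπ1 g).1 this
  · rw [Subgroup.index_map, hker, sup_eq_left.2 fun g (hg : g ∈ C.kernel) => hg.1,
      MonoidHom.range_eq_top.2 hπs, Subgroup.index_top, mul_one, Subgroup.index_ker, hcard]

/-- Some block-fixing `s` outside the kernel fixes a point `x`. On the block of `x` it has `q`-power
order and no other fixed point, so counting its fixed points modulo `q` gives the claim. -/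
theorem QCon.IsSplitting.dvd_sub_one (C : α.IsSplitting p q m n) : q ∣ p ^ m - 1 := by
  have := C.finite
  obtain ⟨x⟩ := C.nonempty
  obtain ⟨K, _, π, -, hker, -, -, -, hK⟩ := C.exists_extraspecial
  obtain ⟨g, hg, hgk⟩ : ∃ g ∈ α.factorHom.ker, g ∉ C.kernel := by
    by_contra h
    push Not at h
    exact C.kernel_ne_ker (le_antisymm (fun g hg => hg.1) h)
  obtain ⟨h, hh, s, hs, hsx, rfl⟩ := C.exists_mul_of_mem_ker hg x
  have hsk : s ∉ C.kernel := fun hsk => hgk (mul_mem hh hsk)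
  have hspow : s ^ q ^ (n + 1) ∈ C.kernel := by
    rw [← hker, MonoidHom.mem_ker, map_pow, ← hK, pow_card_eq_one']
  let t := α.blockHom x ⟨s, hs⟩
  have htx : t (α.base x) = α.base x := Subtype.ext hsx
  have htpow : t ^ q ^ (n + 1) = 1 := by
    have hfix : (t ^ q ^ (n + 1)) (α.base x) = α.base x := by
      generalize q ^ (n + 1) = k
      induction k with
      | zero => rfl
      | succ k ih => rw [pow_succ, Equiv.Perm.mul_apply, htx, ih]
    rw [← map_pow] at hfix ⊢
    ext y
    exact C.apply_eq_of_mem_kernel hspow (congrArg Subtype.val hfix) y.2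
  have h1 := card_modEq_one_of_fix C.prime_factor htpow htx fun y hy => by
    by_contra hyx
    have h1 := (C.block_simple x).eq_one_of_fix (α.blockHom_mem_autGroup x ⟨s, hs⟩) hyx hy htx
    exact hsk (C.mem_kernel_of_isSemiregularAt hs (x := x) (Or.inl fun z hz =>
      congrArg Subtype.val (Equiv.ext_iff.1 h1 ⟨z, hz⟩)))
  rw [C.card_block] at h1
  exact (Nat.modEq_iff_dvd' (Nat.one_le_pow _ _ C.prime_block.pos)).1 h1.symm

theorem exists_addEquiv_pi_zmod {A : Type*} [AddCommGroup A] [Finite A] {p : ℕ} [Fact p.Prime]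
    [Module (ZMod p) A] : ∃ r, Nat.card A = p ^ r ∧ Nonempty (A ≃+ (Fin r → ZMod p)) := by
  have h := Module.natCard_eq_pow_finrank (K := ZMod p) (V := A)
  rw [Nat.card_zmod] at h
  exact ⟨_, h, ⟨(Module.finBasis (ZMod p) A).equivFun.toAddEquiv⟩⟩

theorem exists_mulEquiv_of_pow_eq_one {A : Type*} [Group A] [Finite A] {p : ℕ} (hp : p.Prime)
    (hcomm : ∀ a b : A, a * b = b * a) (hpow : ∀ a : A, a ^ p = 1) :
    ∃ r, Nat.card A = p ^ r ∧ Nonempty (A ≃* Multiplicative (Fin r → ZMod p)) := by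
  have := Fact.mk hp
  let _ : CommGroup A := { (inferInstance : Group A) with mul_comm := hcomm }
  let _ : Module (ZMod p) (Additive A) := AddCommGroup.zmodModule hpow
  obtain ⟨r, hr, ⟨e⟩⟩ := exists_addEquiv_pi_zmod (A := Additive A) (p := p)
  exact ⟨r, hr, ⟨AddEquiv.toMultiplicativeRight e⟩⟩

/-- Evaluation at `x` maps the kernel onto a block, giving rank at least `m`. Evaluation at `x` and
at a point `y` of another block is injective, since an element fixing both is trivial on both
blocks; this gives rank at most `2 * m`. -/
theorem QCon.IsSplitting.exists_kernel_mulEquiv (C : α.IsSplitting p q m n) :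
    ∃ k ≤ m, Nat.card C.kernel = p ^ (m + k) ∧
      Nonempty (C.kernel ≃* Multiplicative (Fin (m + k) → ZMod p)) := by
  have := C.finite
  obtain ⟨x⟩ := C.nonempty
  obtain ⟨r, hr, he⟩ := exists_mulEquiv_of_pow_eq_one (A := C.kernel) C.prime_block
    (fun a b => Subtype.ext (C.kernel_comm a.2 b.2)) (fun a => Subtype.ext (C.kernel_pow a.2))
  obtain ⟨y, hxy⟩ : ∃ y, ¬ α.toSetoid x y := by
    have : Finite α.Factor := Finite.of_surjective _ α.cls_surjective
    have : Nontrivial α.Factor := by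
      rw [← Finite.one_lt_card_iff_nontrivial, C.card_factor]
      exact Nat.one_lt_pow C.ne_zero_factor C.prime_factor.one_lt
    obtain ⟨z, hz⟩ := exists_ne (α.cls x)
    obtain ⟨z, rfl⟩ := α.cls_surjective z
    exact ⟨z, fun h => hz (QCon.cls_eq_cls.2 (α.symm h))⟩
  have hsym : ∀ (g : C.kernel) (z : Q), α.toSetoid z (g.1.1 z) := fun g z =>
    α.symm (QCon.mem_ker.1 g.2.1 z)
  have hlow : p ^ m ≤ p ^ r := by
    rw [← hr, ← C.card_block x]
    refine Nat.card_le_card_of_surjective (fun g : C.kernel => ⟨g.1.1 x, hsym g x⟩) fun z => ?_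
    obtain ⟨g, hg, hgx⟩ := C.kernel_transitive z.2
    exact ⟨⟨g, hg⟩, Subtype.ext hgx⟩
  have hupp : p ^ r ≤ p ^ (m + m) := by
    have hprod : p ^ (m + m) = Nat.card ((α.block x).carrier × (α.block y).carrier) := by
      rw [Nat.card_prod, C.card_block, C.card_block, pow_add]
    rw [← hr, hprod]
    refine Nat.card_le_card_of_injective
      (fun g : C.kernel => ((⟨g.1.1 x, hsym g x⟩, ⟨g.1.1 y, hsym g y⟩) :
        (α.block x).carrier × (α.block y).carrier)) fun g h hgh => ?_
    have h1 : g.1.1 x = h.1.1 x := congrArg (fun z => z.1.1) hgh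
    have h2 : g.1.1 y = h.1.1 y := congrArg (fun z => z.2.1) hgh
    have hfix : ∀ z, g.1.1 z = h.1.1 z → (g⁻¹ * h).1.1 z = z := fun z hz => by
      change g.1.1⁻¹ (h.1.1 z) = z
      rw [Equiv.Perm.inv_eq_iff_eq, hz]
    have h3 := C.eq_one _ (g⁻¹ * h).1.2 x y hxy
      (fun z hz => C.apply_eq_of_mem_kernel (g⁻¹ * h).2 (hfix x h1) hz)
      (fun z hz => C.apply_eq_of_mem_kernel (g⁻¹ * h).2 (hfix y h2) hz)
    exact inv_mul_eq_one.1 (Subtype.ext (Subtype.ext h3))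
  have h1 := (Nat.pow_le_pow_iff_right C.prime_block.one_lt).1 hlow
  have h2 := (Nat.pow_le_pow_iff_right C.prime_block.one_lt).1 hupp
  obtain ⟨k, rfl⟩ := Nat.exists_eq_add_of_le h1
  exact ⟨k, by omega, hr, he⟩

end Splitting

/-- A surjection whose kernel has order coprime to its index splits. -/
theorem exists_mulEquiv_semidirectProduct {G K A : Type*} [Group G] [Finite G] [Group K]
    [Group A] (π : G →* K) (hπ : Function.Surjective π)
    (hcop : Nat.Coprime (Nat.card π.ker) (Nat.card K)) (e : π.ker ≃* A) :
    ∃ ρ : K →* MulAut A, Nonempty (G ≃* A ⋊[ρ] K) := by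
  have hidx : π.ker.index = Nat.card K := by
    rw [Subgroup.index_ker, MonoidHom.range_eq_top.2 hπ]
    exact Nat.card_congr Subgroup.topEquiv.toEquiv
  obtain ⟨H, hH⟩ := Subgroup.exists_right_complement'_of_coprime (N := π.ker) (by rwa [hidx])
  let η : H →* K := π.comp H.subtype
  have hη : Function.Bijective η := by
    constructor
    · rw [injective_iff_map_eq_one]
      intro h hh
      have : h.1 ∈ π.ker ⊓ H := ⟨hh, h.2⟩
      rw [hH.disjoint.eq_bot, Subgroup.mem_bot] at this
      exact Subtype.ext this
    · intro k
      obtain ⟨g, rfl⟩ := hπ k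
      obtain ⟨⟨a, h⟩, rfl⟩ := hH.2 g
      refine ⟨h, ?_⟩
      have : π a.1 = 1 := a.2
      simp [η, this]
  exact ⟨_, ⟨(SemidirectProduct.mulEquivSubgroup hH).symm.trans
    (SemidirectProduct.congr' e (MulEquiv.ofBijective η hη))⟩⟩

end LSSQuandle

theorem mainTheorem12 {Q : Type*} [Quandle Q] {p q m n : ℕ} (hp : p.Prime) (hq : q.Prime)
    (hQ : LSSQuandle.InLSS (p ^ m) (q ^ n) Q (LSSQuandle.sigma Q))
    (hσγ : LSSQuandle.sigma Q ⊓ (LSSQuandle.gamma Q).toSetoid = ⊥) :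
    (∃ k : ℕ, k ≤ m ∧
      ∃ (K : Type) (_ : Group K)
        (ρ : K →* MulAut (Multiplicative (Fin (m + k) → ZMod p))),
        LSSQuandle.IsExtraspecial q K ∧
        Nonempty (LSSQuandle.Dis Q ≃* Multiplicative (Fin (m + k) → ZMod p) ⋊[ρ] K) ∧
        (Odd q → Monoid.exponent K = q)) ∧
    q ∣ p ^ m - 1 ∧ Even n := by
  obtain ⟨α, C⟩ := hQ.exists_isSplitting hp hq hσγ
  have := C.finite
  obtain ⟨K, _, π, hπ, hker, hK, hexp, hn, hcard⟩ := C.exists_extraspecial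
  obtain ⟨k, hk, hcardP, ⟨e⟩⟩ := C.exists_kernel_mulEquiv
  have hdvd := C.dvd_sub_one
  -- Since `m ≠ 0`, the prime `p` cannot divide `p ^ m - 1`. This supplies the coprimality needed
  -- for Schur–Zassenhaus.
  have hpq : p ≠ q := by
    rintro rfl
    have h1 : p ∣ p ^ m := dvd_pow_self p C.ne_zero_block
    have h2 := (Nat.dvd_sub_iff_right (Nat.one_le_pow _ _ hp.pos) h1).1 hdvd
    exact hp.one_lt.ne' (Nat.dvd_one.1 h2)
  obtain ⟨ρ, hρ⟩ := LSSQuandle.exists_mulEquiv_semidirectProduct π hπ (by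
    rw [hker, hcardP, hcard]
    exact Nat.Coprime.pow _ _ ((Nat.coprime_primes hp hq).2 hpq))
    ((MulEquiv.subgroupCongr hker).trans e)
  exact ⟨⟨k, hk, K, inferInstance, ρ, hK, hρ, hexp⟩, hdvd, hn⟩
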